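/- **Setting.** For $\Delta>0$ let $\mathcal{Q}_\Delta(a)=\Delta\big(\lfloor a/\Delta\rfloor+\tfrac12\big)$, applied entrywise to vectors. Let $x_1,\dots,x_n$ be i.i.d. copies of a zero-mean random vector $x\in\mathbb{R}^d$, $d\ge 2$, with $\Sigma^\star=\mathbb{E}(xx^\top)$, and suppose that $\mathbb{E}|v^\top x|^4\le M$ for every $v\in\mathbb{R}^d$ with $\|v\|_2=1$. Let $\tau_1,\dots,\tau_n$ be i.i.d., independent of $x_1,\dots,x_n$, each distributed as the sum of two independent random vectors uniform on $[-\frac\Delta2,\frac\Delta2]^d$ (triangular dither). For a threshold $\zeta>0$ put $$\check x_k=\frac{x_k}{\|x_k\|_4}\min\{\|x_k\|_4,\zeta\}\ \ (\check x_k=0\text{ if }x_k=0),\qquad \dot x_k=\mathcal{Q}_\Delta(\check x_k+\tau_k),\qquad \widehat\Sigma=\frac1n\sum_{k=1}^n\dot x_k\dot x_k^\top-\frac{\Delta^2}{4}I_d ,$$ where $\|x\|_4=(\sum_i|x_i|^4)^{1/4}$, and let $\|\cdot\|_{op}$ denote the operator norm with respect to the Euclidean norm. **Theorem.** For all constants $c_0,c_1,c_2>0$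 there is a constant $C>0$, depending only on $c_0,c_1,c_2$, such that the following holds for all $d\ge2$, $n$, $\delta>0$, $\Delta>0$, $M$ and all distributions of $x$ as above. If $$c_1\,(M^{1/4}+\Delta)\Big(\frac{n}{\delta\log d}\Big)^{1/4}\le\zeta\le c_2\,(M^{1/4}+\Delta)\Big(\frac{n}{\delta\log d}\Big)^{1/4}\qquad\text{and}\qquad n\ge c_0\,\delta d\log d,$$ then $$\mathbb{P}\Big(\|\widehat\Sigma-\Sigma^\star\|_{op}\ge C_\delta\,\big(\sqrt M+\Delta^2\big)\sqrt{\frac{\delta d\log d}{n}}\Big)\le 2d^{-\delta},\qquad C_\delta:=C\max\{1,1/\delta\}.$$ In particular the constant is independent of $\delta$ when $\delta\ge1$. -/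

import Mathlib

open MeasureTheory ProbabilityTheory

namespace QCE

/-- The uniform quantizer with level `Δ > 0` of a real number. -/
noncomputable def quantize (Δ a : ℝ) : ℝ := Δ * ((⌊a / Δ⌋ : ℝ) + 1 / 2)

/-- The `ℓ₄` norm of a vector. -/
noncomputable def l4norm {d : ℕ} (x : Fin d → ℝ) : ℝ := (∑ i, |x i| ^ 4) ^ ((1 : ℝ) / 4)

/-- The `ℓ₄` truncation `(x / ‖x‖₄) · min (‖x‖₄, ζ)`; the zero vector is sent to itself. -/
noncomputable def truncate {d : ℕ} (ζ : ℝ) (x : Fin d → ℝ) : Fin d → ℝ :=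
  (min (l4norm x) ζ / l4norm x) • x

/-- The uniform distribution on the cube `[-Δ/2, Δ/2]^d`. -/
noncomputable def uniformCube (d : ℕ) (Δ : ℝ) : Measure (Fin d → ℝ) :=
  ProbabilityTheory.cond volume (Set.Icc (fun _ => -(Δ / 2)) (fun _ => Δ / 2))

/-- The triangular dither: the law of the sum of two independent uniform vectors on the cube. -/
noncomputable def triangularDither (d : ℕ) (Δ : ℝ) : Measure (Fin d → ℝ) :=
  Measure.conv (uniformCube d Δ) (uniformCube d Δ)

/-- The quantized sample obtained from `x` with truncation threshold `ζ` and dither `τ`. -/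
noncomputable def quantizedSample {d : ℕ} (Δ ζ : ℝ) (x τ : Fin d → ℝ) : Fin d → ℝ :=
  fun i => quantize Δ (truncate ζ x i + τ i)

/-- The estimator: sample second-moment matrix of the quantized samples minus `(Δ² / 4) I`. -/
noncomputable def estimator {n d : ℕ} (Δ ζ : ℝ) (x τ : Fin n → Fin d → ℝ) :
    Matrix (Fin d) (Fin d) ℝ :=
  (1 / (n : ℝ)) • (∑ k, Matrix.vecMulVec (quantizedSample Δ ζ (x k) (τ k))
      (quantizedSample Δ ζ (x k) (τ k))) -
    (Δ ^ 2 / 4) • (1 : Matrix (Fin d) (Fin d) ℝ)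

/-- The matrix `E (x xᵀ)` for a random vector `x` with law `P`. -/
noncomputable def secondMoment {d : ℕ} (P : Measure (Fin d → ℝ)) : Matrix (Fin d) (Fin d) ℝ :=
  Matrix.of fun i j => ∫ x, x i * x j ∂P

/-- The operator norm of a square matrix with respect to the Euclidean norm. -/
noncomputable def opNorm {d : ℕ} (A : Matrix (Fin d) (Fin d) ℝ) : ℝ :=
  ‖Matrix.toEuclideanCLM (𝕜 := ℝ) A‖

end QCE

/-!
Adding the triangular dither before quantizing makes the quantization error of a fixed vector `y`
centered with covariance `(Δ² / 4) I`, whatever `y` is. Hence `E (ẋ ẋᵀ) = E (x̌ x̌ᵀ) + (Δ² / 4) I`,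
and `Σ̂ - Σ⋆` is the average of independent centered random matrices plus the bias
`E (x̌ x̌ᵀ) - E (x xᵀ)` of the truncation, which is at most `M √d / ζ²` by the fourth moment bound.

The random part is controlled by a matrix Bernstein inequality, obtained from the Golden–Thompson
inequality: `ẋ` has fourth moments of order `M + Δ⁴` in every direction, so the squares of the
centered matrices have mean at most a multiple of `d (M + Δ⁴) I`, and the norms of these matrices
are almost surely at most a multiple of `√d ζ² + d Δ²`. With `ρ = √(δ d log d / n)`, the prescribed
size of `ζ` makes the bias of order `(√M + Δ²) ρ`, and the exponential parameter
`θ ≍ ρ / ((√M + Δ²) d)` is then small enough for the almost sure bound and optimal for the variance.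
-/

namespace QCE

open Filter Topology
open scoped Matrix MatrixOrder Matrix.Norms.L2Operator

section GoldenThompson

variable {m : Type*} [Fintype m]

lemma trace_mul_le_half_add (P Q : Matrix m m ℝ) :
    (P * Q).trace ≤ ((P * Pᵀ).trace + (Qᵀ * Q).trace) / 2 := by
  simp only [Matrix.trace, Matrix.diag, Matrix.mul_apply, Matrix.transpose_apply]
  rw [← Finset.sum_add_distrib, Finset.sum_div]
  refine Finset.sum_le_sum fun i _ => ?_
  rw [← Finset.sum_add_distrib, Finset.sum_div]
  exact Finset.sum_le_sum fun j _ => by nlinarith [sq_nonneg (P i j - Q j i)]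

variable [DecidableEq m]

lemma trace_mul_pow_comm (A B : Matrix m m ℝ) (k : ℕ) :
    ((A * B) ^ k).trace = ((B * A) ^ k).trace := by
  cases k with
  | zero => simp
  | succ k =>
    have h : SemiconjBy B (A * B) (B * A) := by
      simp only [SemiconjBy, mul_assoc]
    rw [pow_succ, ← mul_assoc, Matrix.trace_mul_comm, ← mul_assoc, (h.pow_right k).eq, mul_assoc,
      ← pow_succ]

lemma trace_mul_pow_le_of_trace_pow_le {N : ℕ}
    (hprod : ∀ P Q : Matrix m m ℝ, P.IsSymm → Q.IsSymm →
      ((P * Q) ^ N).trace ≤ (P ^ N * Q ^ N).trace)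
    (hpow : ∀ Z : Matrix m m ℝ, (Z ^ (2 * N)).trace ≤ ((Z * Zᵀ) ^ N).trace)
    {P Q : Matrix m m ℝ} (hP : P.IsSymm) (hQ : Q.IsSymm) :
    ((P * Q) ^ (2 * N)).trace ≤ (P ^ (2 * N) * Q ^ (2 * N)).trace :=
  calc ((P * Q) ^ (2 * N)).trace ≤ ((P * Q * (P * Q)ᵀ) ^ N).trace := hpow _
    _ = ((P * (Q * Q) * P) ^ N).trace := by
      rw [Matrix.transpose_mul, hP.eq, hQ.eq]; simp only [mul_assoc]
    _ = ((P ^ 2 * Q ^ 2) ^ N).trace := by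
      rw [trace_mul_pow_comm]; simp only [pow_two, mul_assoc]
    _ ≤ ((P ^ 2) ^ N * (Q ^ 2) ^ N).trace := hprod _ _ (hP.pow 2) (hQ.pow 2)
    _ = (P ^ (2 * N) * Q ^ (2 * N)).trace := by rw [← pow_mul, ← pow_mul]

lemma trace_pow_two_mul_le_of_trace_mul_pow_le {N : ℕ}
    (hprod : ∀ P Q : Matrix m m ℝ, P.IsSymm → Q.IsSymm →
      ((P * Q) ^ N).trace ≤ (P ^ N * Q ^ N).trace)
    (hpow : ∀ Z : Matrix m m ℝ, (Z ^ (2 * N)).trace ≤ ((Z * Zᵀ) ^ N).trace)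
    (Z : Matrix m m ℝ) :
    (Z ^ (2 * (2 * N))).trace ≤ ((Z * Zᵀ) ^ (2 * N)).trace := by
  have hl : (Zᵀ * Z).IsSymm := Matrix.isSymm_transpose_mul_self Z
  have hr : (Z * Zᵀ).IsSymm := Matrix.isSymm_mul_transpose_self Z
  calc (Z ^ (2 * (2 * N))).trace = ((Z ^ 2) ^ (2 * N)).trace := by rw [pow_mul]
    _ ≤ ((Z ^ 2 * (Z ^ 2)ᵀ) ^ N).trace := hpow _
    _ = ((Z * (Z * (Zᵀ * Zᵀ))) ^ N).trace := by
      rw [Matrix.transpose_pow]; simp only [pow_two, mul_assoc]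
    _ = ((Z * Zᵀ * (Zᵀ * Z)) ^ N).trace := by
      rw [trace_mul_pow_comm]; simp only [mul_assoc]
    _ ≤ ((Z * Zᵀ) ^ N * (Zᵀ * Z) ^ N).trace := hprod _ _ hr hl
    _ ≤ (((Z * Zᵀ) ^ N * ((Z * Zᵀ) ^ N)ᵀ).trace + (((Zᵀ * Z) ^ N)ᵀ * (Zᵀ * Z) ^ N).trace) / 2 :=
      trace_mul_le_half_add _ _
    _ = ((Z * Zᵀ) ^ (2 * N)).trace := by
      rw [(hr.pow N).eq, (hl.pow N).eq, ← pow_add, ← pow_add, ← two_mul,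
        trace_mul_pow_comm Zᵀ, add_self_div_two]

lemma trace_mul_pow_two_pow_le_and (k : ℕ) :
    (∀ P Q : Matrix m m ℝ, P.IsSymm → Q.IsSymm →
      ((P * Q) ^ 2 ^ k).trace ≤ (P ^ 2 ^ k * Q ^ 2 ^ k).trace) ∧
    ∀ Z : Matrix m m ℝ, (Z ^ (2 * 2 ^ k)).trace ≤ ((Z * Zᵀ) ^ 2 ^ k).trace := by
  induction k with
  | zero =>
    refine ⟨fun P Q _ _ => by simp, fun Z => ?_⟩
    have h := trace_mul_le_half_add Z Z
    rwa [Matrix.trace_mul_comm Zᵀ, add_self_div_two, ← pow_two, ← pow_one (Z * Zᵀ)] at h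
  | succ k ih =>
    rw [pow_succ' 2 k]
    exact ⟨fun P Q => trace_mul_pow_le_of_trace_pow_le ih.1 ih.2,
      trace_pow_two_mul_le_of_trace_mul_pow_le ih.1 ih.2⟩

lemma norm_exp_le_exp_norm {𝔸 : Type*} [NormedRing 𝔸] [NormedAlgebra ℝ 𝔸] [CompleteSpace 𝔸]
    [NormOneClass 𝔸] (x : 𝔸) : ‖NormedSpace.exp x‖ ≤ Real.exp ‖x‖ := by
  have hs := NormedSpace.expSeries_div_summable (𝔸 := ℝ) ‖x‖
  rw [NormedSpace.exp_eq_tsum ℝ, Real.exp_eq_exp_ℝ, NormedSpace.exp_eq_tsum_div]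
  refine tsum_of_norm_bounded hs.hasSum fun n => ?_
  rw [norm_smul, norm_inv, div_eq_inv_mul, Real.norm_natCast]
  gcongr
  exact norm_pow_le x n

lemma norm_pow_sub_pow_le {𝔸 : Type*} [NormedRing 𝔸] [NormOneClass 𝔸] {X Y : 𝔸} {c : ℝ}
    (hX : ‖X‖ ≤ c) (hY : ‖Y‖ ≤ c) (hc : 1 ≤ c) (N : ℕ) :
    ‖X ^ N - Y ^ N‖ ≤ N * ‖X - Y‖ * c ^ N := by
  induction N with
  | zero => simp
  | succ N ih =>
    have telescope : X ^ (N + 1) - Y ^ (N + 1) = X * (X ^ N - Y ^ N) + (X - Y) * Y ^ N := by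
      rw [pow_succ', pow_succ']; noncomm_ring
    have hYN : ‖Y ^ N‖ ≤ c ^ (N + 1) :=
      ((norm_pow_le Y N).trans (pow_le_pow_left₀ (norm_nonneg _) hY N)).trans
        (pow_le_pow_right₀ hc N.le_succ)
    calc ‖X ^ (N + 1) - Y ^ (N + 1)‖ ≤ ‖X‖ * ‖X ^ N - Y ^ N‖ + ‖X - Y‖ * ‖Y ^ N‖ := by
          rw [telescope]
          exact (norm_add_le _ _).trans (add_le_add (norm_mul_le _ _) (norm_mul_le _ _))
      _ ≤ c * (N * ‖X - Y‖ * c ^ N) + ‖X - Y‖ * c ^ (N + 1) := by gcongr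
      _ = (N + 1 : ℕ) * ‖X - Y‖ * c ^ (N + 1) := by push_cast; ring

section LieProduct

variable {𝔸 : Type*} [NormedRing 𝔸] [NormedAlgebra ℝ 𝔸] [CompleteSpace 𝔸]

lemma exp_inv_natCast_smul_pow (A : 𝔸) {N : ℕ} (hN : N ≠ 0) :
    NormedSpace.exp ((N : ℝ)⁻¹ • A) ^ N = NormedSpace.exp A := by
  let _ : NormedAlgebra ℚ 𝔸 := NormedAlgebra.restrictScalars ℚ ℝ 𝔸
  rw [← NormedSpace.exp_nsmul, ← Nat.cast_smul_eq_nsmul ℝ, smul_smul,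
    mul_inv_cancel₀ (Nat.cast_ne_zero.2 hN), one_smul]

lemma tendsto_natCast_mul_norm_exp_mul_exp_sub_exp (A B : 𝔸) :
    Tendsto (fun N : ℕ => (N : ℝ) *
      ‖NormedSpace.exp ((N : ℝ)⁻¹ • A) * NormedSpace.exp ((N : ℝ)⁻¹ • B) -
        NormedSpace.exp ((N : ℝ)⁻¹ • (A + B))‖) atTop (𝓝 0) := by
  have hderiv : HasDerivAt (fun t : ℝ => NormedSpace.exp (t • A) * NormedSpace.exp (t • B) -
      NormedSpace.exp (t • (A + B))) 0 0 := by
    have h := ((hasDerivAt_exp_smul_const (𝕂 := ℝ) A (0 : ℝ)).mul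
      (hasDerivAt_exp_smul_const (𝕂 := ℝ) B (0 : ℝ))).sub
      (hasDerivAt_exp_smul_const (𝕂 := ℝ) (A + B) (0 : ℝ))
    simpa [Pi.mul_def, Pi.sub_def] using h
  have hinv : Tendsto (fun N : ℕ => (N : ℝ)⁻¹) atTop (𝓝[>] 0) :=
    tendsto_inv_atTop_nhdsGT_zero.comp tendsto_natCast_atTop_atTop
  have h := hderiv.tendsto_slope_zero_right.norm.comp hinv
  rw [norm_zero] at h
  exact h.congr fun N => by simp [norm_smul]

lemma tendsto_exp_mul_exp_pow [NormOneClass 𝔸] (A B : 𝔸) :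
    Tendsto (fun N : ℕ => (NormedSpace.exp ((N : ℝ)⁻¹ • A) *
      NormedSpace.exp ((N : ℝ)⁻¹ • B)) ^ N) atTop (𝓝 (NormedSpace.exp (A + B))) := by
  have hlim := (tendsto_natCast_mul_norm_exp_mul_exp_sub_exp A B).mul_const (Real.exp (‖A‖ + ‖B‖))
  rw [zero_mul] at hlim
  rw [tendsto_iff_norm_sub_tendsto_zero]
  refine squeeze_zero' (Eventually.of_forall fun _ => norm_nonneg _) ?_ hlim
  filter_upwards [eventually_ne_atTop 0] with N hN
  have hnorm (W : 𝔸) : ‖NormedSpace.exp ((N : ℝ)⁻¹ • W)‖ ≤ Real.exp ((N : ℝ)⁻¹ * ‖W‖) :=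
    (norm_exp_le_exp_norm _).trans_eq (by rw [norm_smul, norm_inv, Real.norm_natCast])
  have hroot : Real.exp (‖A‖ + ‖B‖) = Real.exp ((N : ℝ)⁻¹ * (‖A‖ + ‖B‖)) ^ N := by
    rw [← Real.exp_nat_mul, mul_inv_cancel_left₀ (Nat.cast_ne_zero.2 hN)]
  rw [← exp_inv_natCast_smul_pow (A + B) hN, hroot]
  refine norm_pow_sub_pow_le ?_ ?_ (Real.one_le_exp (by positivity)) N
  · rw [mul_add, Real.exp_add]
    exact (norm_mul_le _ _).trans (mul_le_mul (hnorm A) (hnorm B) (norm_nonneg _) (by positivity))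
  · refine (hnorm _).trans (Real.exp_le_exp.2 ?_)
    gcongr
    exact norm_add_le A B

end LieProduct

/-- The Golden–Thompson inequality. -/
theorem trace_exp_add_le {A B : Matrix m m ℝ} (hA : A.IsHermitian) (hB : B.IsHermitian) :
    (NormedSpace.exp (A + B)).trace ≤ (NormedSpace.exp A * NormedSpace.exp B).trace := by
  cases isEmpty_or_nonempty m
  · simp [Matrix.trace]
  have hlie := (tendsto_exp_mul_exp_pow A B).comp
    (tendsto_pow_atTop_atTop_of_one_lt (one_lt_two (α := ℕ)))
  have htrace : Continuous (fun W : Matrix m m ℝ => W.trace) := by fun_prop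
  refine le_of_tendsto ((htrace.tendsto _).comp hlie) (Eventually.of_forall fun k => ?_)
  have hsymm {W : Matrix m m ℝ} (hW : W.IsHermitian) (c : ℝ) :
      (NormedSpace.exp (c • W)).IsSymm :=
    (hW.smul (IsSelfAdjoint.all c)).exp
  have h := (trace_mul_pow_two_pow_le_and k).1 _ _ (hsymm hA ((2 ^ k : ℕ) : ℝ)⁻¹)
    (hsymm hB ((2 ^ k : ℕ) : ℝ)⁻¹)
  rwa [exp_inv_natCast_smul_pow A (by positivity), exp_inv_natCast_smul_pow B (by positivity)] at h

end GoldenThompson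

section LoewnerOrder

instance {m : Type*} [Finite m] : OrderClosedTopology (Matrix m m ℝ) := by
  cases nonempty_fintype m
  refine ⟨isClosed_le_of_isClosed_nonneg ?_⟩
  have h : {A : Matrix m m ℝ | 0 ≤ A} =
      {A | Aᴴ = A} ∩ ⋂ v : m → ℝ, {A | 0 ≤ star v ⬝ᵥ A *ᵥ v} := by
    ext A
    simp [Matrix.nonneg_iff_posSemidef, Matrix.posSemidef_iff_dotProduct_mulVec, Matrix.IsHermitian]
  rw [h]
  exact (isClosed_eq (by fun_prop) continuous_id).inter
    (isClosed_iInter fun v => isClosed_le continuous_const (by fun_prop))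

variable {m : Type*} [Fintype m]

lemma trace_mul_le_trace_mul {P A B : Matrix m m ℝ} (hP : 0 ≤ P) (hAB : A ≤ B) :
    (P * A).trace ≤ (P * B).trace := by
  classical
  obtain ⟨S, rfl⟩ := CStarAlgebra.nonneg_iff_eq_star_mul_self.1 hP
  have h := ((Matrix.le_iff.1 hAB).mul_mul_conjTranspose_same S).trace_nonneg
  rw [Matrix.mul_sub, Matrix.sub_mul, Matrix.trace_sub, sub_nonneg] at h
  simp only [Matrix.trace_mul_comm _ Sᴴ, ← mul_assoc] at h
  exact h

variable [DecidableEq m]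

lemma norm_eq_norm_eigenvalues {A : Matrix m m ℝ} (hA : A.IsHermitian) :
    ‖A‖ = ‖hA.eigenvalues‖ := by
  conv_lhs => rw [hA.spectral_theorem, Unitary.conjStarAlgAut_apply]
  rw [← Unitary.coe_star, CStarRing.norm_mul_coe_unitary, CStarRing.norm_coe_unitary_mul,
    Matrix.l2_opNorm_diagonal]
  rfl

lemma trace_cfc {A : Matrix m m ℝ} (hA : A.IsHermitian) (f : ℝ → ℝ) :
    (cfc f A).trace = ∑ i, f (hA.eigenvalues i) := by
  rw [hA.cfc_eq, Matrix.IsHermitian.cfc, Unitary.conjStarAlgAut_apply, Matrix.trace_mul_comm,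
    ← mul_assoc, Unitary.coe_star_mul_self, one_mul, Matrix.trace_diagonal]
  rfl

lemma eigenvectorBasis_dotProduct_self {A : Matrix m m ℝ} (hA : A.IsHermitian) (i : m) :
    (hA.eigenvectorBasis i).ofLp ⬝ᵥ (hA.eigenvectorBasis i).ofLp = 1 := by
  have h := inner_self_eq_one_of_norm_eq_one (𝕜 := ℝ) (hA.eigenvectorBasis.orthonormal.1 i)
  rwa [EuclideanSpace.inner_eq_star_dotProduct, star_trivial] at h

lemma norm_le_of_abs_dotProduct_mulVec_le {A : Matrix m m ℝ} (hA : A.IsHermitian) {c : ℝ}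
    (hc : 0 ≤ c) (h : ∀ v : m → ℝ, v ⬝ᵥ v = 1 → |v ⬝ᵥ A *ᵥ v| ≤ c) : ‖A‖ ≤ c := by
  rw [norm_eq_norm_eigenvalues hA, pi_norm_le_iff_of_nonneg hc]
  intro i
  have hunit := eigenvectorBasis_dotProduct_self hA i
  simpa [hA.mulVec_eigenvectorBasis, hunit] using h _ hunit

lemma le_smul_one_of_dotProduct_mulVec_le {A : Matrix m m ℝ} (hA : A.IsHermitian) {c : ℝ}
    (h : ∀ v : m → ℝ, v ⬝ᵥ v = 1 → v ⬝ᵥ A *ᵥ v ≤ c) : A ≤ c • (1 : Matrix m m ℝ) := by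
  have hA' : IsSelfAdjoint A := hA
  rw [← Algebra.algebraMap_eq_smul_one]
  refine le_algebraMap_of_spectrum_le fun x hx => ?_
  obtain ⟨i, rfl⟩ := hA.spectrum_real_eq_range_eigenvalues ▸ hx
  have hunit := eigenvectorBasis_dotProduct_self hA i
  simpa [hA.mulVec_eigenvectorBasis, hunit] using h _ hunit

lemma exp_norm_le_trace_exp_add [Nonempty m] {A : Matrix m m ℝ} (hA : A.IsHermitian) :
    Real.exp ‖A‖ ≤ (NormedSpace.exp A).trace + (NormedSpace.exp (-A)).trace := by
  obtain ⟨i, hi⟩ := Finite.exists_max fun i => |hA.eigenvalues i|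
  have hnorm : ‖A‖ ≤ |hA.eigenvalues i| :=
    (norm_eq_norm_eigenvalues hA).trans_le ((pi_norm_le_iff_of_nonneg (abs_nonneg _)).2 hi)
  have hneg : NormedSpace.exp (-A) = cfc (fun x => Real.exp (-x)) A := by
    have hA' : IsSelfAdjoint A := hA
    rw [← CFC.real_exp_eq_normedSpace_exp hA'.neg, ← cfc_comp_neg Real.exp A]
  rw [← CFC.real_exp_eq_normedSpace_exp hA, hneg, trace_cfc hA, trace_cfc hA,
    ← Finset.sum_add_distrib]
  calc Real.exp ‖A‖ ≤ Real.exp |hA.eigenvalues i| := Real.exp_le_exp.2 hnorm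
    _ ≤ Real.exp (hA.eigenvalues i) + Real.exp (-hA.eigenvalues i) := Real.exp_abs_le _
    _ ≤ _ := Finset.single_le_sum (f := fun j => Real.exp (hA.eigenvalues j) +
        Real.exp (-hA.eigenvalues j)) (fun j _ => by positivity) (Finset.mem_univ i)

lemma exp_nonneg {A : Matrix m m ℝ} (hA : A.IsHermitian) : 0 ≤ NormedSpace.exp A := by
  rw [← CFC.real_exp_eq_normedSpace_exp hA]
  exact cfc_nonneg fun x _ => (Real.exp_pos x).le

lemma exp_le_one_add_add_sq {A : Matrix m m ℝ} (hA : A.IsHermitian) (hnorm : ‖A‖ ≤ 1) :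
    NormedSpace.exp A ≤ 1 + A + A ^ 2 := by
  have hA' : IsSelfAdjoint A := hA
  have hpoly : cfc (fun x : ℝ => 1 + x + x ^ 2) A = 1 + A + A ^ 2 := by
    rw [cfc_add .., cfc_add .., cfc_const_one .., cfc_id' .., cfc_pow_id ..]
  rw [← CFC.real_exp_eq_normedSpace_exp hA, ← hpoly]
  refine cfc_mono fun x hx => ?_
  obtain ⟨i, rfl⟩ := hA.spectrum_real_eq_range_eigenvalues ▸ hx
  have hi : |hA.eigenvalues i| ≤ 1 :=
    (norm_le_pi_norm _ i).trans ((norm_eq_norm_eigenvalues hA).symm.trans_le hnorm)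
  linarith [(abs_le.1 (Real.abs_exp_sub_one_sub_id_le hi)).2]

end LoewnerOrder

section Bernstein

variable {m Ω ι : Type*} [Fintype m] [DecidableEq m] [MeasurableSpace Ω] {μ : Measure Ω}

lemma integral_trace {Y : Ω → Matrix m m ℝ} (hY : Integrable Y μ) :
    ∫ ω, (Y ω).trace ∂μ = (∫ ω, Y ω ∂μ).trace :=
  (Matrix.traceLinearMap m ℝ ℝ).toContinuousLinearMap.integral_comp_comm hY

lemma integrable_trace {Y : Ω → Matrix m m ℝ} (hY : Integrable Y μ) :
    Integrable (fun ω => (Y ω).trace) μ :=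
  (Matrix.traceLinearMap m ℝ ℝ).toContinuousLinearMap.integrable_comp hY

lemma integrable_exp_of_norm_le [IsFiniteMeasure μ] {X : Ω → Matrix m m ℝ}
    (hX : AEStronglyMeasurable X μ) {c : ℝ} (hc : ∀ᵐ ω ∂μ, ‖X ω‖ ≤ c) :
    Integrable (fun ω => NormedSpace.exp (X ω)) μ := by
  cases isEmpty_or_nonempty m
  · exact (integrable_const (0 : Matrix m m ℝ)).congr (ae_of_all _ fun _ => Subsingleton.elim _ _)
  let _ : NormedAlgebra ℚ (Matrix m m ℝ) := NormedAlgebra.restrictScalars ℚ ℝ _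
  refine .of_bound (NormedSpace.exp_continuous.comp_aestronglyMeasurable hX) (Real.exp c) ?_
  filter_upwards [hc] with ω hω
  exact (norm_exp_le_exp_norm _).trans (Real.exp_le_exp.2 hω)

lemma integral_trace_exp_add_le [MeasurableSpace (Matrix m m ℝ)] [BorelSpace (Matrix m m ℝ)]
    {S X : Ω → Matrix m m ℝ} (hSX : S ⟂ᵢ[μ] X)
    (hS : ∀ ω, (S ω).IsHermitian) (hX : ∀ ω, (X ω).IsHermitian)
    (hSint : Integrable (fun ω => NormedSpace.exp (S ω)) μ)
    (hXint : Integrable (fun ω => NormedSpace.exp (X ω)) μ)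
    (hSXint : Integrable (fun ω => NormedSpace.exp (S ω + X ω)) μ) {c : ℝ}
    (hc : ∫ ω, NormedSpace.exp (X ω) ∂μ ≤ c • 1) :
    ∫ ω, (NormedSpace.exp (S ω + X ω)).trace ∂μ ≤ c * ∫ ω, (NormedSpace.exp (S ω)).trace ∂μ := by
  let _ : NormedAlgebra ℚ (Matrix m m ℝ) := NormedAlgebra.restrictScalars ℚ ℝ _
  have hexp : Measurable (NormedSpace.exp : Matrix m m ℝ → Matrix m m ℝ) :=
    NormedSpace.exp_continuous.measurable
  have hindep := hSX.comp hexp hexp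
  have hmul : Integrable (fun ω => NormedSpace.exp (S ω) * NormedSpace.exp (X ω)) μ :=
    hindep.integrable_bilin hSint hXint (.mul ℝ _)
  calc ∫ ω, (NormedSpace.exp (S ω + X ω)).trace ∂μ
      ≤ ∫ ω, (NormedSpace.exp (S ω) * NormedSpace.exp (X ω)).trace ∂μ :=
        integral_mono (integrable_trace hSXint) (integrable_trace hmul) fun ω =>
          trace_exp_add_le (hS ω) (hX ω)
    _ = ((∫ ω, NormedSpace.exp (S ω) ∂μ) * ∫ ω, NormedSpace.exp (X ω) ∂μ).trace := by
        rw [integral_trace hmul]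
        exact congrArg Matrix.trace (hindep.integral_bilin hSint hXint (.mul ℝ _))
    _ ≤ ((∫ ω, NormedSpace.exp (S ω) ∂μ) * c • 1).trace :=
        trace_mul_le_trace_mul (integral_nonneg fun ω => exp_nonneg (hS ω)) hc
    _ = c * ∫ ω, (NormedSpace.exp (S ω)).trace ∂μ := by
        rw [mul_smul_comm, mul_one, Matrix.trace_smul, smul_eq_mul, integral_trace hSint]

variable [IsProbabilityMeasure μ]

lemma integral_exp_le {X : Ω → Matrix m m ℝ} {q : ℝ} (hX : AEStronglyMeasurable X μ)
    (hherm : ∀ ω, (X ω).IsHermitian) (hbound : ∀ᵐ ω ∂μ, ‖X ω‖ ≤ 1) (hmean : ∫ ω, X ω ∂μ = 0)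
    (hvar : ∫ ω, X ω ^ 2 ∂μ ≤ q • 1) :
    ∫ ω, NormedSpace.exp (X ω) ∂μ ≤ (1 + q) • 1 := by
  have hint : Integrable X μ := .of_bound hX 1 hbound
  have hint' : Integrable (fun ω => X ω ^ 2) μ := by
    refine .of_bound (hX.pow 2) (1 ^ 2) ?_
    filter_upwards [hbound] with ω hω
    exact (norm_pow_le' _ two_pos).trans (pow_le_pow_left₀ (norm_nonneg _) hω 2)
  calc ∫ ω, NormedSpace.exp (X ω) ∂μ ≤ ∫ ω, (1 + X ω + X ω ^ 2) ∂μ := by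
        refine integral_mono_ae (integrable_exp_of_norm_le hX hbound)
          (((integrable_const _).add hint).add hint') ?_
        filter_upwards [hbound] with ω hω using exp_le_one_add_add_sq (hherm ω) hω
    _ = 1 + ∫ ω, X ω ^ 2 ∂μ := by
        rw [integral_add (f := fun ω => 1 + X ω) ((integrable_const _).add hint) hint',
          integral_add (integrable_const _) hint, hmean]
        simp
    _ ≤ (1 + q) • 1 := by
        rw [add_smul, one_smul]
        gcongr

variable [MeasurableSpace (Matrix m m ℝ)] [BorelSpace (Matrix m m ℝ)]

variable {X : ι → Ω → Matrix m m ℝ} {q : ℝ}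

lemma integral_trace_exp_sum_le (hq : 0 ≤ q) (hindep : iIndepFun X μ)
    (hX : ∀ k, AEMeasurable (X k) μ) (hherm : ∀ k ω, (X k ω).IsHermitian)
    (hbound : ∀ k, ∀ᵐ ω ∂μ, ‖X k ω‖ ≤ 1) (hmean : ∀ k, ∫ ω, X k ω ∂μ = 0)
    (hvar : ∀ k, ∫ ω, X k ω ^ 2 ∂μ ≤ q • 1) (s : Finset ι) :
    Integrable (fun ω => NormedSpace.exp (∑ k ∈ s, X k ω)) μ ∧
      ∫ ω, (NormedSpace.exp (∑ k ∈ s, X k ω)).trace ∂μ ≤ (1 + q) ^ s.card * Fintype.card m := by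
  classical
  have hsum (s : Finset ι) : AEStronglyMeasurable (fun ω => ∑ k ∈ s, X k ω) μ :=
    Finset.aestronglyMeasurable_fun_sum s fun k _ => (hX k).aestronglyMeasurable
  have hsumherm (s : Finset ι) (ω : Ω) : (∑ k ∈ s, X k ω).IsHermitian := by
    simp only [Matrix.IsHermitian, Matrix.conjTranspose_sum, fun k => (hherm k ω).eq]
  have hint (s : Finset ι) : Integrable (fun ω => NormedSpace.exp (∑ k ∈ s, X k ω)) μ := by
    refine integrable_exp_of_norm_le (hsum s) (c := s.card) ?_
    filter_upwards [(Filter.eventually_all_finset s).2 fun k _ => hbound k] with ω hω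
    exact (norm_sum_le_of_le s hω).trans_eq (by simp)
  refine ⟨hint s, ?_⟩
  induction s using Finset.induction_on with
  | empty => simp
  | insert k s hk ih =>
    have hsk : (fun ω => ∑ j ∈ s, X j ω) ⟂ᵢ[μ] X k := by
      simpa only [Finset.sum_fn] using hindep.indepFun_finsetSum_of_notMem₀ hX hk
    have hk' : Integrable (fun ω => NormedSpace.exp (X k ω)) μ := by simpa using hint {k}
    have hinsert := hint (insert k s)
    simp only [Finset.sum_insert hk, add_comm (X k _)] at hinsert ⊢
    calc ∫ ω, (NormedSpace.exp (∑ j ∈ s, X j ω + X k ω)).trace ∂μ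
        ≤ (1 + q) * ∫ ω, (NormedSpace.exp (∑ j ∈ s, X j ω)).trace ∂μ :=
          integral_trace_exp_add_le hsk (hsumherm s) (hherm k) (hint s) hk' hinsert <|
            integral_exp_le (hX k).aestronglyMeasurable (hherm k) (hbound k) (hmean k) (hvar k)
      _ ≤ (1 + q) * ((1 + q) ^ s.card * Fintype.card m) := by gcongr
      _ = (1 + q) ^ (insert k s).card * Fintype.card m := by
          rw [Finset.card_insert_of_notMem hk]; ring

/-- A matrix Bernstein inequality. -/
theorem measureReal_le_norm_sum_le [Nonempty m] [Fintype ι] (hq : 0 ≤ q) (hindep : iIndepFun X μ)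
    (hX : ∀ k, AEMeasurable (X k) μ) (hherm : ∀ k ω, (X k ω).IsHermitian)
    (hbound : ∀ k, ∀ᵐ ω ∂μ, ‖X k ω‖ ≤ 1) (hmean : ∀ k, ∫ ω, X k ω ∂μ = 0)
    (hvar : ∀ k, ∫ ω, X k ω ^ 2 ∂μ ≤ q • 1) (t : ℝ) :
    μ.real {ω | t ≤ ‖∑ k, X k ω‖} ≤
      2 * Fintype.card m * Real.exp (Fintype.card ι * q - t) := by
  set S : Ω → Matrix m m ℝ := fun ω => ∑ k, X k ω
  have hS (ω : Ω) : (S ω).IsHermitian := by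
    simp only [S, Matrix.IsHermitian, Matrix.conjTranspose_sum, fun k => (hherm k ω).eq]
  obtain ⟨hint, hle⟩ := integral_trace_exp_sum_le hq hindep hX hherm hbound hmean hvar .univ
  obtain ⟨hint', hle'⟩ := integral_trace_exp_sum_le (X := fun k ω => -X k ω) hq
    (hindep.comp (fun _ A => -A) fun _ => measurable_neg) (fun k => (hX k).neg)
    (fun k ω => (hherm k ω).neg) (by simpa using hbound) (by simpa [integral_neg] using hmean)
    (by simpa using hvar) .univ
  simp only [Finset.sum_neg_distrib] at hint' hle'
  have hpow : (1 + q) ^ (Finset.univ : Finset ι).card ≤ Real.exp (Fintype.card ι * q) := by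
    rw [Real.exp_nat_mul, Finset.card_univ]
    exact pow_le_pow_left₀ (by linarith) (by linarith [Real.add_one_le_exp q]) _
  have hmarkov : Real.exp t * μ.real {ω | t ≤ ‖S ω‖} ≤
      2 * Fintype.card m * Real.exp (Fintype.card ι * q) :=
    calc Real.exp t * μ.real {ω | t ≤ ‖S ω‖}
        ≤ Real.exp t * μ.real {ω | Real.exp t ≤
            (NormedSpace.exp (S ω)).trace + (NormedSpace.exp (-S ω)).trace} := by
          refine mul_le_mul_of_nonneg_left (measureReal_mono fun ω hω => ?_) (Real.exp_pos t).le
          exact (Real.exp_le_exp.2 hω).trans (exp_norm_le_trace_exp_add (hS ω))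
      _ ≤ ∫ ω, ((NormedSpace.exp (S ω)).trace + (NormedSpace.exp (-S ω)).trace) ∂μ :=
          mul_meas_ge_le_integral_of_nonneg
            (ae_of_all _ fun ω => (Real.exp_pos _).le.trans (exp_norm_le_trace_exp_add (hS ω)))
            ((integrable_trace hint).add (integrable_trace hint')) _
      _ ≤ Real.exp (Fintype.card ι * q) * Fintype.card m +
            Real.exp (Fintype.card ι * q) * Fintype.card m := by
          rw [integral_add (integrable_trace hint) (integrable_trace hint')]
          exact add_le_add (hle.trans (by gcongr)) (hle'.trans (by gcongr))
      _ = 2 * Fintype.card m * Real.exp (Fintype.card ι * q) := by ring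
  rw [Real.exp_sub, mul_div_assoc', le_div_iff₀' (Real.exp_pos t)]
  exact hmarkov

theorem measureReal_le_norm_sum_le_of_norm_le [Nonempty m] [Fintype ι] (hq : 0 ≤ q)
    (hindep : iIndepFun X μ) (hX : ∀ k, AEMeasurable (X k) μ)
    (hherm : ∀ k ω, (X k ω).IsHermitian) {L : ℝ} (hbound : ∀ k, ∀ᵐ ω ∂μ, ‖X k ω‖ ≤ L)
    (hmean : ∀ k, ∫ ω, X k ω ∂μ = 0) (hvar : ∀ k, ∫ ω, X k ω ^ 2 ∂μ ≤ q • 1) {θ : ℝ}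
    (hθ : 0 < θ) (hθL : θ * L ≤ 1) (t : ℝ) :
    μ.real {ω | t ≤ ‖∑ k, X k ω‖} ≤
      2 * Fintype.card m * Real.exp (Fintype.card ι * (θ ^ 2 * q) - θ * t) := by
  have hscaled := measureReal_le_norm_sum_le (X := fun k ω => θ • X k ω) (q := θ ^ 2 * q)
    (by positivity) (hindep.comp (fun _ A => θ • A) fun _ => measurable_const_smul θ)
    (fun k => (hX k).const_smul θ) (fun k ω => (hherm k ω).smul (.all θ))
    (fun k => (hbound k).mono fun ω hω => by
      rw [norm_smul, Real.norm_of_nonneg hθ.le]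
      exact (mul_le_mul_of_nonneg_left hω hθ.le).trans hθL)
    (fun k => by rw [integral_smul, hmean k, smul_zero])
    (fun k => by
      simp only [smul_pow, integral_smul, mul_smul]
      exact smul_le_smul_of_nonneg_left (hvar k) (sq_nonneg θ))
    (θ * t)
  simpa only [← Finset.smul_sum, norm_smul, Real.norm_of_nonneg hθ.le,
    mul_le_mul_iff_right₀ hθ] using hscaled

end Bernstein

section Dither

/-- The uniform distribution on `[-Δ/2, Δ/2]`, the law of a coordinate of `uniformCube`. -/
noncomputable def uniformInterval (Δ : ℝ) : Measure ℝ :=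
  ProbabilityTheory.cond volume (Set.Icc (-(Δ / 2)) (Δ / 2))

/-- The triangular distribution on `[-Δ, Δ]`, the law of a coordinate of `triangularDither`. -/
noncomputable def triangular (Δ : ℝ) : Measure ℝ :=
  Measure.conv (uniformInterval Δ) (uniformInterval Δ)

/-- The quantization error `𝒬(s) - s`. -/
noncomputable def quantizeError (Δ s : ℝ) : ℝ := quantize Δ s - s

/-- The total error `𝒬(a + t) - a` of quantizing `a` with dither `t`. -/
noncomputable def ditherError (Δ a t : ℝ) : ℝ := quantize Δ (a + t) - a

lemma ditherError_eq_add_quantizeError (Δ a t : ℝ) :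
    ditherError Δ a t = t + quantizeError Δ (a + t) := by
  unfold ditherError quantizeError; ring

@[fun_prop]
lemma measurable_quantize (Δ : ℝ) : Measurable (quantize Δ) := by
  have : Measurable fun a : ℝ => ((⌊a / Δ⌋ : ℤ) : ℝ) :=
    measurable_from_top.comp (Int.measurable_floor.comp (measurable_id.div_const Δ))
  unfold quantize
  fun_prop

@[fun_prop]
lemma measurable_quantizeError (Δ : ℝ) : Measurable (quantizeError Δ) :=
  (measurable_quantize Δ).sub measurable_id

@[fun_prop]
lemma measurable_ditherError (Δ a : ℝ) : Measurable (ditherError Δ a) := by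
  unfold ditherError
  fun_prop

instance (Δ : ℝ) : IsFiniteMeasure (uniformInterval Δ) := by
  unfold uniformInterval
  infer_instance

lemma ae_abs_le_uniformInterval (Δ : ℝ) : ∀ᵐ v ∂uniformInterval Δ, |v| ≤ Δ / 2 := by
  filter_upwards [ae_cond_mem (μ := volume) (measurableSet_Icc (a := -(Δ / 2)) (b := Δ / 2))]
    with v hv using abs_le.2 hv

lemma ae_abs_le_uniformInterval_prod (Δ : ℝ) :
    ∀ᵐ z ∂(uniformInterval Δ).prod (uniformInterval Δ), |z.1| ≤ Δ / 2 ∧ |z.2| ≤ Δ / 2 :=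
  (Measure.quasiMeasurePreserving_fst.ae (ae_abs_le_uniformInterval Δ)).and
    (Measure.quasiMeasurePreserving_snd.ae (ae_abs_le_uniformInterval Δ))

lemma integral_triangular (Δ : ℝ) {f : ℝ → ℝ} (hf : Measurable f) :
    ∫ t, f t ∂triangular Δ =
      ∫ z, f (z.1 + z.2) ∂(uniformInterval Δ).prod (uniformInterval Δ) :=
  integral_map (by fun_prop) hf.aestronglyMeasurable

lemma ae_abs_le_triangular (Δ : ℝ) : ∀ᵐ t ∂triangular Δ, |t| ≤ Δ := by
  rw [triangular, Measure.conv, ae_map_iff (by fun_prop)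
    (measurableSet_le (f := fun t => |t|) (by fun_prop) measurable_const)]
  filter_upwards [ae_abs_le_uniformInterval_prod Δ] with z ⟨hz₁, hz₂⟩
  linarith [abs_add_le z.1 z.2]

variable {Δ : ℝ}

lemma isProbabilityMeasure_uniformInterval (hΔ : 0 < Δ) :
    IsProbabilityMeasure (uniformInterval Δ) :=
  cond_isProbabilityMeasure_of_finite (by simp [hΔ]) (by simp)

lemma isProbabilityMeasure_triangular (hΔ : 0 < Δ) : IsProbabilityMeasure (triangular Δ) := by
  have := isProbabilityMeasure_uniformInterval hΔ
  unfold triangular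
  infer_instance

lemma uniformCube_eq_pi (d : ℕ) (hΔ : 0 < Δ) :
    uniformCube d Δ = Measure.pi fun _ : Fin d => uniformInterval Δ := by
  have := isProbabilityMeasure_uniformInterval hΔ
  refine (Measure.pi_eq fun s _ => ?_).symm
  simp only [uniformCube, uniformInterval, cond_apply measurableSet_Icc]
  rw [← Set.pi_univ_Icc, ← Set.pi_inter_distrib, volume_pi, Measure.pi_pi, Measure.pi_pi,
    Finset.prod_mul_distrib, ENNReal.prod_inv_distrib]
  exact fun _ _ _ _ _ => .inr (by simp)

lemma triangularDither_eq_pi (d : ℕ) (hΔ : 0 < Δ) :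
    triangularDither d Δ = Measure.pi fun _ : Fin d => triangular Δ := by
  have := isProbabilityMeasure_uniformInterval hΔ
  have := isProbabilityMeasure_triangular hΔ
  have h := measurePreserving_arrowProdEquivProdArrow ℝ ℝ (Fin d)
    (fun _ => uniformInterval Δ) (fun _ => uniformInterval Δ)
  rw [triangularDither, uniformCube_eq_pi d hΔ, Measure.conv, ← h.map_eq,
    Measure.map_map (by fun_prop) h.measurable]
  exact Measure.pi_map_pi (μ := fun _ : Fin d => (uniformInterval Δ).prod (uniformInterval Δ))
    (f := fun _ (z : ℝ × ℝ) => z.1 + z.2) fun _ => by fun_prop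

lemma integral_uniformInterval (hΔ : 0 < Δ) (f : ℝ → ℝ) :
    ∫ v, f v ∂uniformInterval Δ = Δ⁻¹ * ∫ v in (-(Δ / 2))..(Δ / 2), f v := by
  rw [intervalIntegral.integral_of_le (by linarith), ← integral_Icc_eq_integral_Ioc,
    uniformInterval, ProbabilityTheory.cond, integral_smul_measure, Real.volume_Icc,
    sub_neg_eq_add, add_halves, ENNReal.toReal_inv, ENNReal.toReal_ofReal hΔ.le, smul_eq_mul]

lemma abs_quantizeError_le (hΔ : 0 < Δ) (s : ℝ) : |quantizeError Δ s| ≤ Δ / 2 := by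
  have h1 := (le_div_iff₀ hΔ).1 (Int.floor_le (s / Δ))
  have h2 := (div_le_iff₀ hΔ).1 (Int.lt_floor_add_one (s / Δ)).le
  rw [quantizeError, quantize, abs_le]
  constructor <;> linarith

lemma periodic_quantizeError (hΔ : 0 < Δ) : Function.Periodic (quantizeError Δ) Δ := by
  intro s
  rw [quantizeError, quantizeError, quantize, quantize, add_div, div_self hΔ.ne',
    Int.floor_add_one, Int.cast_add, Int.cast_one]
  ring

lemma quantizeError_of_mem_Ico {s : ℝ} (hs : s ∈ Set.Ico 0 Δ) :
    quantizeError Δ s = Δ / 2 - s := by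
  have hΔ : 0 < Δ := hs.1.trans_lt hs.2
  have : ⌊s / Δ⌋ = 0 := Int.floor_eq_zero_iff.2 ⟨div_nonneg hs.1 hΔ.le, (div_lt_one hΔ).2 hs.2⟩
  rw [quantizeError, quantize, this, Int.cast_zero]
  ring

lemma integral_comp_quantizeError (hΔ : 0 < Δ) (g : ℝ → ℝ) (b : ℝ) :
    ∫ v, g (quantizeError Δ (b + v)) ∂uniformInterval Δ = ∫ v, g v ∂uniformInterval Δ := by
  have hper : Function.Periodic (fun s => g (quantizeError Δ s)) Δ := fun s => by
    simp only [periodic_quantizeError hΔ s]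
  have hshift := hper.intervalIntegral_add_eq (b + -(Δ / 2)) 0
  rw [zero_add, show b + -(Δ / 2) + Δ = b + Δ / 2 by ring] at hshift
  have hreflect := intervalIntegral.integral_comp_sub_left (a := 0) (b := Δ) g (Δ / 2)
  rw [show Δ / 2 - Δ = -(Δ / 2) by ring, sub_zero] at hreflect
  rw [integral_uniformInterval hΔ, integral_uniformInterval hΔ,
    intervalIntegral.integral_comp_add_left (fun s => g (quantizeError Δ s)) b, hshift, ← hreflect]
  congr 1
  refine intervalIntegral.integral_congr_ae ?_
  filter_upwards [Measure.ae_ne volume Δ] with s hs hmem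
  rw [Set.uIoc_of_le hΔ.le] at hmem
  rw [quantizeError_of_mem_Ico ⟨hmem.1.le, lt_of_le_of_ne hmem.2 hs⟩]

lemma integral_id_uniformInterval (hΔ : 0 < Δ) : ∫ v, v ∂uniformInterval Δ = 0 := by
  rw [integral_uniformInterval hΔ, integral_id]
  ring

lemma integral_sq_uniformInterval (hΔ : 0 < Δ) : ∫ v, v ^ 2 ∂uniformInterval Δ = Δ ^ 2 / 12 := by
  rw [integral_uniformInterval hΔ, integral_pow]
  field_simp
  ring

lemma integral_quantizeError (hΔ : 0 < Δ) (b : ℝ) :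
    ∫ v, quantizeError Δ (b + v) ∂uniformInterval Δ = 0 :=
  (integral_comp_quantizeError hΔ (fun s => s) b).trans (integral_id_uniformInterval hΔ)

lemma integral_quantizeError_sq (hΔ : 0 < Δ) (b : ℝ) :
    ∫ v, quantizeError Δ (b + v) ^ 2 ∂uniformInterval Δ = Δ ^ 2 / 12 :=
  (integral_comp_quantizeError hΔ (fun s => s ^ 2) b).trans (integral_sq_uniformInterval hΔ)

lemma abs_ditherError_le (hΔ : 0 < Δ) (a : ℝ) {t : ℝ} (ht : |t| ≤ Δ) :
    |ditherError Δ a t| ≤ 3 / 2 * Δ := by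
  rw [ditherError_eq_add_quantizeError]
  linarith [abs_add_le t (quantizeError Δ (a + t)), abs_quantizeError_le hΔ (a + t)]

lemma memLp_fst_uniformInterval_prod (Δ : ℝ) (p : ENNReal) :
    MemLp Prod.fst p ((uniformInterval Δ).prod (uniformInterval Δ)) :=
  .of_bound (by fun_prop) (Δ / 2) <| (ae_abs_le_uniformInterval_prod Δ).mono fun _ hz => hz.1

lemma memLp_snd_uniformInterval_prod (Δ : ℝ) (p : ENNReal) :
    MemLp Prod.snd p ((uniformInterval Δ).prod (uniformInterval Δ)) :=
  .of_bound (by fun_prop) (Δ / 2) <| (ae_abs_le_uniformInterval_prod Δ).mono fun _ hz => hz.2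

lemma memLp_quantizeError_uniformInterval_prod (hΔ : 0 < Δ) (a : ℝ) (p : ENNReal) :
    MemLp (fun z : ℝ × ℝ => quantizeError Δ (a + (z.1 + z.2))) p
      ((uniformInterval Δ).prod (uniformInterval Δ)) :=
  .of_bound ((measurable_quantizeError Δ).comp (by fun_prop)).aestronglyMeasurable (Δ / 2)
    (ae_of_all _ fun _ => abs_quantizeError_le hΔ _)

lemma integral_ditherError (hΔ : 0 < Δ) (a : ℝ) : ∫ t, ditherError Δ a t ∂triangular Δ = 0 := by
  have := isProbabilityMeasure_uniformInterval hΔ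
  have hfst := (memLp_fst_uniformInterval_prod Δ 1).integrable le_rfl
  have hsnd := (memLp_snd_uniformInterval_prod Δ 1).integrable le_rfl
  have hquant := (memLp_quantizeError_uniformInterval_prod hΔ a 1).integrable le_rfl
  rw [integral_triangular Δ (measurable_ditherError Δ a)]
  simp only [ditherError_eq_add_quantizeError]
  rw [integral_add (hfst.fun_add hsnd) hquant, integral_add hfst hsnd, integral_prod _ hfst,
    integral_prod _ hsnd, integral_prod _ hquant]
  simp [← add_assoc, integral_quantizeError hΔ, integral_id_uniformInterval hΔ]

lemma integral_fst_mul_snd_uniformInterval_prod (hΔ : 0 < Δ) :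
    ∫ z, z.1 * z.2 ∂(uniformInterval Δ).prod (uniformInterval Δ) = 0 := by
  rw [integral_prod_mul (fun s => s) fun s => s, integral_id_uniformInterval hΔ, mul_zero]

lemma integral_fst_mul_quantizeError (hΔ : 0 < Δ) (a : ℝ) :
    ∫ z, z.1 * quantizeError Δ (a + (z.1 + z.2)) ∂(uniformInterval Δ).prod (uniformInterval Δ) =
      0 := by
  have hint : Integrable (fun z : ℝ × ℝ => z.1 * quantizeError Δ (a + (z.1 + z.2)))
      ((uniformInterval Δ).prod (uniformInterval Δ)) :=
    (memLp_fst_uniformInterval_prod Δ 2).integrable_mul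
      (memLp_quantizeError_uniformInterval_prod hΔ a 2)
  rw [integral_prod _ hint]
  simp [← add_assoc, integral_const_mul, integral_quantizeError hΔ]

lemma integral_snd_mul_quantizeError (hΔ : 0 < Δ) (a : ℝ) :
    ∫ z, z.2 * quantizeError Δ (a + (z.1 + z.2)) ∂(uniformInterval Δ).prod (uniformInterval Δ) =
      0 := by
  rw [← integral_prod_swap, ← integral_fst_mul_quantizeError hΔ a]
  simp only [Prod.fst_swap, Prod.snd_swap, add_comm]

lemma integral_add_sq_of_integral_mul_eq_zero {Ω : Type*} [MeasurableSpace Ω] {μ : Measure Ω}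
    {f g : Ω → ℝ} (hf : MemLp f 2 μ) (hg : MemLp g 2 μ) (hfg : ∫ ω, f ω * g ω ∂μ = 0) :
    ∫ ω, (f ω + g ω) ^ 2 ∂μ = ∫ ω, f ω ^ 2 ∂μ + ∫ ω, g ω ^ 2 ∂μ := by
  have hmul : Integrable (fun ω => f ω * g ω) μ := hf.integrable_mul hg
  have hexpand (ω : Ω) : (f ω + g ω) ^ 2 = f ω ^ 2 + g ω ^ 2 + 2 * (f ω * g ω) := by ring
  simp only [hexpand]
  rw [integral_add (hf.integrable_sq.fun_add hg.integrable_sq) (hmul.const_mul 2),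
    integral_add hf.integrable_sq hg.integrable_sq, integral_const_mul, hfg, mul_zero, add_zero]

/-- The two uniform components of the dither and the quantization error are pairwise orthogonal,
each with second moment `Δ² / 12`. -/
lemma integral_ditherError_sq (hΔ : 0 < Δ) (a : ℝ) :
    ∫ t, ditherError Δ a t ^ 2 ∂triangular Δ = Δ ^ 2 / 4 := by
  have := isProbabilityMeasure_uniformInterval hΔ
  have hfst := memLp_fst_uniformInterval_prod Δ 2
  have hsnd := memLp_snd_uniformInterval_prod Δ 2
  have hquant := memLp_quantizeError_uniformInterval_prod hΔ a 2
  have horth : ∫ z, (z.1 + z.2) * quantizeError Δ (a + (z.1 + z.2))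
      ∂(uniformInterval Δ).prod (uniformInterval Δ) = 0 := by
    simpa only [add_mul, Pi.mul_apply, integral_fst_mul_quantizeError hΔ,
      integral_snd_mul_quantizeError hΔ, add_zero] using
      integral_add (hfst.integrable_mul hquant) (hsnd.integrable_mul hquant)
  rw [integral_triangular Δ ((measurable_ditherError Δ a).pow_const 2)]
  simp only [ditherError_eq_add_quantizeError]
  rw [integral_add_sq_of_integral_mul_eq_zero (f := fun z => z.1 + z.2) (hfst.add hsnd) hquant
      horth,
    integral_add_sq_of_integral_mul_eq_zero hfst hsnd
      (integral_fst_mul_snd_uniformInterval_prod hΔ),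
    integral_prod _ hfst.integrable_sq, integral_prod _ hsnd.integrable_sq,
    integral_prod _ hquant.integrable_sq]
  simp only [← add_assoc, integral_sq_uniformInterval hΔ, integral_quantizeError_sq hΔ,
    integral_const, probReal_univ, smul_eq_mul, one_mul]
  ring

end Dither

section SecondMoment

lemma isHermitian_vecMulVec_self {m : Type*} (y : m → ℝ) : (Matrix.vecMulVec y y).IsHermitian :=
  Matrix.isHermitian_iff_isSymm.2 (Matrix.transpose_vecMulVec y y)

variable {m Ω : Type*} [Fintype m] [MeasurableSpace Ω] {μ : Measure Ω}

lemma integrable_dotProduct_mulVec [DecidableEq m] {Y : Ω → Matrix m m ℝ} (hY : Integrable Y μ)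
    (v w : m → ℝ) : Integrable (fun ω => v ⬝ᵥ Y ω *ᵥ w) μ := by
  have h := (LinearMap.applyₗ w ∘ₗ LinearMap.applyₗ v ∘ₗ
    (Matrix.toBilin' (R₁ := ℝ) (n := m)).toLinearMap).toContinuousLinearMap.integrable_comp hY
  simpa [Matrix.toBilin'_apply'] using h

lemma integral_dotProduct_mulVec [DecidableEq m] {Y : Ω → Matrix m m ℝ} (hY : Integrable Y μ)
    (v w : m → ℝ) : ∫ ω, v ⬝ᵥ Y ω *ᵥ w ∂μ = v ⬝ᵥ (∫ ω, Y ω ∂μ) *ᵥ w := by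
  have h := (LinearMap.applyₗ w ∘ₗ LinearMap.applyₗ v ∘ₗ
    (Matrix.toBilin' (R₁ := ℝ) (n := m)).toLinearMap).toContinuousLinearMap.integral_comp_comm hY
  simpa [Matrix.toBilin'_apply'] using h

lemma dotProduct_vecMulVec_mulVec (y v : m → ℝ) :
    v ⬝ᵥ Matrix.vecMulVec y y *ᵥ v = (v ⬝ᵥ y) ^ 2 := by
  rw [Matrix.vecMulVec_mulVec, dotProduct_comm y v]
  simp [pow_two]

lemma vecMulVec_self_sq [DecidableEq m] (y : m → ℝ) :
    Matrix.vecMulVec y y ^ 2 = (y ⬝ᵥ y) • Matrix.vecMulVec y y := by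
  rw [pow_two, Matrix.vecMulVec_mul_vecMulVec, Matrix.vecMulVec_smul]

variable {d : ℕ} {P : Measure (Fin d → ℝ)}

lemma isHermitian_secondMoment (P : Measure (Fin d → ℝ)) : (secondMoment P).IsHermitian := by
  ext i j
  simp [secondMoment, mul_comm]

lemma integrable_vecMulVec_self (hP : ∀ i, MemLp (fun y => y i) 2 P) :
    Integrable (fun y => Matrix.vecMulVec y y) P := by
  have hsum (y : Fin d → ℝ) : Matrix.vecMulVec y y =
      ∑ i, ∑ j, (y i * y j) • Matrix.single i j (1 : ℝ) := by
    simpa [Matrix.vecMulVec_apply] using Matrix.matrix_eq_sum_single (Matrix.vecMulVec y y)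
  simp only [hsum]
  exact integrable_finsetSum _ fun i _ => integrable_finsetSum _ fun j _ =>
    ((hP i).integrable_mul (hP j)).smul_const _

lemma integral_vecMulVec_self (hP : ∀ i, MemLp (fun y => y i) 2 P) :
    ∫ y, Matrix.vecMulVec y y ∂P = secondMoment P := by
  ext i j
  simpa [secondMoment, Matrix.vecMulVec_apply] using
    (integral_dotProduct_mulVec (integrable_vecMulVec_self hP) (Pi.single i 1)
      (Pi.single j 1)).symm

lemma integrable_dotProduct_sq (hP : ∀ i, MemLp (fun y => y i) 2 P) (v : Fin d → ℝ) :
    Integrable (fun y => (v ⬝ᵥ y) ^ 2) P := by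
  simpa only [dotProduct_vecMulVec_mulVec] using
    integrable_dotProduct_mulVec (integrable_vecMulVec_self hP) v v

lemma dotProduct_secondMoment_mulVec (hP : ∀ i, MemLp (fun y => y i) 2 P) (v : Fin d → ℝ) :
    v ⬝ᵥ secondMoment P *ᵥ v = ∫ y, (v ⬝ᵥ y) ^ 2 ∂P := by
  rw [← integral_vecMulVec_self hP, ← integral_dotProduct_mulVec (integrable_vecMulVec_self hP)]
  simp only [dotProduct_vecMulVec_mulVec]

end SecondMoment

/-- The hypothesis `E |vᵀ x|⁴ ≤ M` for all unit vectors `v`, for a random vector `x` with law `P`.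
-/
def HasFourthMomentBound {d : ℕ} (P : Measure (Fin d → ℝ)) (M : ℝ) : Prop :=
  ∀ v : Fin d → ℝ, v ⬝ᵥ v = 1 →
    Integrable (fun y => |v ⬝ᵥ y| ^ 4) P ∧ ∫ y, |v ⬝ᵥ y| ^ 4 ∂P ≤ M

namespace HasFourthMomentBound

variable {d : ℕ} {P : Measure (Fin d → ℝ)} {M : ℝ}

lemma eval (hP : HasFourthMomentBound P M) (i : Fin d) :
    Integrable (fun y => |y i| ^ 4) P ∧ ∫ y, |y i| ^ 4 ∂P ≤ M := by
  simpa using hP (Pi.single i 1) (by simp)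

lemma nonneg (hP : HasFourthMomentBound P M) (i : Fin d) : 0 ≤ M :=
  (integral_nonneg fun y => by positivity).trans (hP.eval i).2

lemma integrable_sum (hP : HasFourthMomentBound P M) :
    Integrable (fun y => ∑ i, |y i| ^ 4) P :=
  integrable_finsetSum _ fun i _ => (hP.eval i).1

lemma integral_sum_le (hP : HasFourthMomentBound P M) : ∫ y, ∑ i, |y i| ^ 4 ∂P ≤ d * M := by
  rw [integral_finsetSum _ fun i _ => (hP.eval i).1]
  exact (Finset.sum_le_sum fun i _ => (hP.eval i).2).trans_eq (by simp)

lemma memLp_eval [IsFiniteMeasure P] (hP : HasFourthMomentBound P M) (i : Fin d) :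
    MemLp (fun y => y i) 2 P := by
  have h4 : MemLp (fun y : Fin d → ℝ => y i) 4 P := by
    rw [← integrable_norm_rpow_iff (measurable_pi_apply i).aestronglyMeasurable (by norm_num)
      (by norm_num)]
    simpa only [ENNReal.toReal_ofNat, Real.rpow_ofNat, Real.norm_eq_abs] using (hP.eval i).1
  exact h4.mono_exponent (by norm_num)

end HasFourthMomentBound

section MapFourthMoment

variable {d : ℕ} {Ω : Type*} [MeasurableSpace Ω] {μ : Measure Ω} {M K : ℝ} {Y Z : Ω → Fin d → ℝ}

lemma hasFourthMomentBound_map_iff (hY : Measurable Y) :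
    HasFourthMomentBound (μ.map Y) M ↔ ∀ v : Fin d → ℝ, v ⬝ᵥ v = 1 →
      Integrable (fun ω => |v ⬝ᵥ Y ω| ^ 4) μ ∧ ∫ ω, |v ⬝ᵥ Y ω| ^ 4 ∂μ ≤ M := by
  have hmeas (v : Fin d → ℝ) : AEStronglyMeasurable (fun y => |v ⬝ᵥ y| ^ 4) (μ.map Y) :=
    Measurable.aestronglyMeasurable (by unfold dotProduct; fun_prop)
  refine forall₂_congr fun v _ => ?_
  rw [integrable_map_measure (hmeas v) hY.aemeasurable, integral_map hY.aemeasurable (hmeas v)]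
  rfl

lemma HasFourthMomentBound.map_add (hY : Measurable Y) (hZ : Measurable Z)
    (hYM : HasFourthMomentBound (μ.map Y) M) (hZK : HasFourthMomentBound (μ.map Z) K) :
    HasFourthMomentBound (μ.map (Y + Z)) (8 * (M + K)) := by
  rw [hasFourthMomentBound_map_iff hY] at hYM
  rw [hasFourthMomentBound_map_iff hZ] at hZK
  rw [hasFourthMomentBound_map_iff (hY.add hZ)]
  intro v hv
  obtain ⟨hYint, hYle⟩ := hYM v hv
  obtain ⟨hZint, hZle⟩ := hZK v hv
  have hpoint (ω : Ω) : |v ⬝ᵥ (Y + Z) ω| ^ 4 ≤ 8 * (|v ⬝ᵥ Y ω| ^ 4 + |v ⬝ᵥ Z ω| ^ 4) := by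
    simp only [Pi.add_apply, dotProduct_add, Even.pow_abs (by decide : Even 4)]
    calc (v ⬝ᵥ Y ω + v ⬝ᵥ Z ω) ^ 4 ≤ 2 ^ 3 * ((v ⬝ᵥ Y ω) ^ 4 + (v ⬝ᵥ Z ω) ^ 4) :=
          Even.add_pow_le (by decide)
      _ = _ := by norm_num
  have hbound : Integrable (fun ω => 8 * (|v ⬝ᵥ Y ω| ^ 4 + |v ⬝ᵥ Z ω| ^ 4)) μ :=
    (hYint.add hZint).const_mul 8
  have hint : Integrable (fun ω => |v ⬝ᵥ (Y + Z) ω| ^ 4) μ := by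
    refine hbound.mono' (Measurable.aestronglyMeasurable ?_) (ae_of_all _ fun ω => ?_)
    · unfold dotProduct; fun_prop
    · rw [norm_pow, Real.norm_eq_abs, abs_abs]
      exact hpoint ω
  refine ⟨hint, (integral_mono hint hbound hpoint).trans ?_⟩
  rw [integral_const_mul, integral_add hYint hZint]
  gcongr

end MapFourthMoment

section DitherVector

variable {d : ℕ} {Δ : ℝ}

lemma isProbabilityMeasure_triangularDither (d : ℕ) (hΔ : 0 < Δ) :
    IsProbabilityMeasure (triangularDither d Δ) := by
  have := isProbabilityMeasure_triangular hΔ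
  rw [triangularDither_eq_pi d hΔ]
  infer_instance

lemma integral_eval_triangularDither (hΔ : 0 < Δ) (i : Fin d) {f : ℝ → ℝ} (hf : Measurable f) :
    ∫ t, f (t i) ∂triangularDither d Δ = ∫ s, f s ∂triangular Δ := by
  have := isProbabilityMeasure_triangular hΔ
  rw [triangularDither_eq_pi d hΔ]
  exact integral_comp_eval hf.aestronglyMeasurable

lemma ae_abs_le_triangularDither (hΔ : 0 < Δ) :
    ∀ᵐ t ∂triangularDither d Δ, ∀ i, |t i| ≤ Δ := by
  have := isProbabilityMeasure_triangular hΔ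
  rw [ae_all_iff, triangularDither_eq_pi d hΔ]
  exact fun i => (Measure.quasiMeasurePreserving_eval (fun _ => triangular Δ) i).ae
    (ae_abs_le_triangular Δ)

lemma ae_abs_ditherError_le (hΔ : 0 < Δ) :
    ∀ᵐ t ∂triangularDither d Δ, ∀ (a : ℝ) (i : Fin d), |ditherError Δ a (t i)| ≤ 3 / 2 * Δ := by
  filter_upwards [ae_abs_le_triangularDither hΔ] with t ht a i
  exact abs_ditherError_le hΔ a (ht i)

lemma memLp_ditherError (hΔ : 0 < Δ) (a : ℝ) (i : Fin d) :
    MemLp (fun t => ditherError Δ a (t i)) 2 (triangularDither d Δ) := by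
  have := isProbabilityMeasure_triangularDither d hΔ
  refine .of_bound (Measurable.aestronglyMeasurable (by fun_prop)) (3 / 2 * Δ) ?_
  filter_upwards [ae_abs_ditherError_le hΔ] with t ht using ht a i

lemma iIndepFun_ditherError (hΔ : 0 < Δ) (a : Fin d → ℝ) :
    iIndepFun (fun i (t : Fin d → ℝ) => ditherError Δ (a i) (t i)) (triangularDither d Δ) := by
  have := isProbabilityMeasure_triangular hΔ
  rw [triangularDither_eq_pi d hΔ]
  exact iIndepFun_pi (X := fun i => ditherError Δ (a i))
    fun i => (measurable_ditherError Δ (a i)).aemeasurable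

lemma integral_ditherError_eval (hΔ : 0 < Δ) (a : ℝ) (i : Fin d) :
    ∫ t, ditherError Δ a (t i) ∂triangularDither d Δ = 0 := by
  rw [integral_eval_triangularDither hΔ i (measurable_ditherError Δ a), integral_ditherError hΔ]

lemma integral_ditherError_mul_ditherError (hΔ : 0 < Δ) (a : Fin d → ℝ) (i j : Fin d) :
    ∫ t, ditherError Δ (a i) (t i) * ditherError Δ (a j) (t j) ∂triangularDither d Δ =
      if i = j then Δ ^ 2 / 4 else 0 := by
  split_ifs with hij
  · subst hij
    simp only [← pow_two]
    rw [integral_eval_triangularDither hΔ i ((measurable_ditherError Δ (a i)).pow_const 2),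
      integral_ditherError_sq hΔ]
  · rw [((iIndepFun_ditherError hΔ a).indepFun hij).integral_fun_mul_eq_mul_integral
      (memLp_ditherError hΔ _ i).1 (memLp_ditherError hΔ _ j).1, integral_ditherError_eval hΔ,
      zero_mul]

lemma integral_quantize_mul_quantize (hΔ : 0 < Δ) (a : Fin d → ℝ) (i j : Fin d) :
    ∫ t, quantize Δ (a i + t i) * quantize Δ (a j + t j) ∂triangularDither d Δ =
      a i * a j + if i = j then Δ ^ 2 / 4 else 0 := by
  have := isProbabilityMeasure_triangularDither d hΔ
  have hint (i : Fin d) : Integrable (fun t => ditherError Δ (a i) (t i)) (triangularDither d Δ) :=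
    (memLp_ditherError hΔ _ i).integrable one_le_two
  have hmul : Integrable (fun t => ditherError Δ (a i) (t i) * ditherError Δ (a j) (t j))
      (triangularDither d Δ) := (memLp_ditherError hΔ _ i).integrable_mul (memLp_ditherError hΔ _ j)
  have hexpand (t : Fin d → ℝ) : quantize Δ (a i + t i) * quantize Δ (a j + t j) =
      a i * a j + a i * ditherError Δ (a j) (t j) + a j * ditherError Δ (a i) (t i) +
        ditherError Δ (a i) (t i) * ditherError Δ (a j) (t j) := by
    unfold ditherError; ring
  simp only [hexpand]
  rw [integral_add ((((integrable_const _).fun_add ((hint j).const_mul _))).fun_add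
      ((hint i).const_mul _)) hmul,
    integral_add ((integrable_const _).fun_add ((hint j).const_mul _)) ((hint i).const_mul _),
    integral_add (integrable_const _) ((hint j).const_mul _),
    integral_ditherError_mul_ditherError hΔ]
  simp [integral_const_mul, integral_ditherError_eval hΔ]

end DitherVector

section SubGaussian

variable {Ω : Type*} [MeasurableSpace Ω] {μ : Measure Ω}

lemma pow_four_le_exp_add_exp (x : ℝ) : x ^ 4 ≤ 24 * (Real.exp x + Real.exp (-x)) := by
  have h : |x| ^ 4 ≤ 24 * Real.exp |x| := by
    linarith [Real.pow_div_factorial_le_exp |x| (abs_nonneg x) 4,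
      show |x| ^ 4 / (Nat.factorial 4 : ℕ) = |x| ^ 4 / 24 by norm_num [Nat.factorial]]
  rw [← Even.pow_abs (by decide : Even 4) x]
  rcases abs_choice x with h' | h' <;> rw [h'] at h ⊢ <;>
    linarith [Real.exp_pos x, Real.exp_pos (-x)]

lemma integral_pow_four_le_of_hasSubgaussianMGF {Z : Ω → ℝ} {c : NNReal}
    (hZ : HasSubgaussianMGF Z c μ) (hc : 0 < c) :
    ∫ ω, Z ω ^ 4 ∂μ ≤ 96 * (c : ℝ) ^ 2 := by
  obtain ⟨b, hb, hbc⟩ : ∃ b : ℝ, 0 < b ∧ b ^ 2 = c :=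
    ⟨√c, Real.sqrt_pos.2 hc, Real.sq_sqrt c.coe_nonneg⟩
  have hpoint (ω : Ω) :
      Z ω ^ 4 ≤ 24 * b ^ 4 * (Real.exp (b⁻¹ * Z ω) + Real.exp (-b⁻¹ * Z ω)) := by
    have := mul_le_mul_of_nonneg_left (pow_four_le_exp_add_exp (b⁻¹ * Z ω)) (pow_pos hb 4).le
    rw [← mul_pow, mul_inv_cancel_left₀ hb.ne'] at this
    rw [neg_mul]
    linarith
  have hmgf {s : ℝ} (hs : s ^ 2 = (b ^ 2)⁻¹) : ∫ ω, Real.exp (s * Z ω) ∂μ ≤ 2 := by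
    refine (hZ.mgf_le s).trans ?_
    rw [hs, ← hbc, mul_inv_cancel₀ (by positivity)]
    calc Real.exp (1 / 2) ≤ Real.exp (Real.log 2) :=
          Real.exp_le_exp.2 (by linarith [Real.log_two_gt_d9])
      _ = 2 := Real.exp_log two_pos
  have hdom : Integrable
      (fun ω => 24 * b ^ 4 * (Real.exp (b⁻¹ * Z ω) + Real.exp (-b⁻¹ * Z ω))) μ :=
    ((hZ.integrable_exp_mul b⁻¹).fun_add (hZ.integrable_exp_mul (-b⁻¹))).const_mul _
  have hint : Integrable (fun ω => Z ω ^ 4) μ := by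
    refine hdom.mono' (hZ.aestronglyMeasurable.pow 4) (ae_of_all _ fun ω => ?_)
    rw [Real.norm_of_nonneg (by positivity)]
    exact hpoint ω
  calc ∫ ω, Z ω ^ 4 ∂μ
      ≤ ∫ ω, 24 * b ^ 4 * (Real.exp (b⁻¹ * Z ω) + Real.exp (-b⁻¹ * Z ω)) ∂μ :=
        integral_mono hint hdom hpoint
    _ = 24 * b ^ 4 * (∫ ω, Real.exp (b⁻¹ * Z ω) ∂μ + ∫ ω, Real.exp (-b⁻¹ * Z ω) ∂μ) := by
        rw [integral_const_mul, integral_add (hZ.integrable_exp_mul _) (hZ.integrable_exp_mul _)]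
    _ ≤ 24 * b ^ 4 * (2 + 2) := by
        gcongr
        · exact hmgf (inv_pow b 2)
        · exact hmgf (by rw [neg_sq, inv_pow])
    _ = 96 * (c : ℝ) ^ 2 := by rw [← hbc]; ring

lemma hasSubgaussianMGF_dotProduct_of_abs_le {ι : Type*} [Fintype ι] [IsProbabilityMeasure μ]
    {X : ι → Ω → ℝ} (hindep : iIndepFun X μ) (hX : ∀ i, AEMeasurable (X i) μ) {b : NNReal}
    (hbound : ∀ i, ∀ᵐ ω ∂μ, |X i ω| ≤ b) (hmean : ∀ i, ∫ ω, X i ω ∂μ = 0) {v : ι → ℝ}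
    (hv : v ⬝ᵥ v = 1) : HasSubgaussianMGF (fun ω => v ⬝ᵥ fun i => X i ω) (b ^ 2) μ := by
  have hsub (i : ι) : HasSubgaussianMGF (fun ω => v i * X i ω) (‖v i‖₊ ^ 2 * b ^ 2) μ := by
    have h := (hasSubgaussianMGF_of_mem_Icc_of_integral_eq_zero (hX i)
      ((hbound i).mono fun ω hω => abs_le.1 hω) (hmean i)).const_mul (v i)
    have hcoeff : ‖v i‖₊ ^ 2 * b ^ 2 =
        NNReal.mk (v i ^ 2) (sq_nonneg _) * (‖(b : ℝ) - -b‖₊ / 2) ^ 2 := by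
      rw [sub_neg_eq_add, ← two_mul]
      exact NNReal.eq (by simp)
    rwa [hcoeff]
  have hsum := HasSubgaussianMGF.sum_of_iIndepFun (s := .univ)
    (hindep.comp (fun i s => v i * s) fun i => by fun_prop) fun i _ => hsub i
  have hconst : ∑ i, ‖v i‖₊ ^ 2 * b ^ 2 = b ^ 2 := by
    have hv' : ∑ i, v i ^ 2 = 1 := by simpa [dotProduct, ← pow_two] using hv
    exact NNReal.eq (by simp [← Finset.sum_mul, hv'])
  rwa [hconst] at hsum

lemma integral_dotProduct_ditherError_pow_four_le {d : ℕ} {Δ : ℝ} (hΔ : 0 < Δ) (a : Fin d → ℝ)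
    {v : Fin d → ℝ} (hv : v ⬝ᵥ v = 1) :
    ∫ t, (v ⬝ᵥ fun i => ditherError Δ (a i) (t i)) ^ 4 ∂triangularDither d Δ ≤ 486 * Δ ^ 4 := by
  have := isProbabilityMeasure_triangularDither d hΔ
  have hsub := hasSubgaussianMGF_dotProduct_of_abs_le (b := ⟨3 / 2 * Δ, by positivity⟩)
    (iIndepFun_ditherError hΔ a) (fun i => Measurable.aemeasurable (by fun_prop))
    (fun i => (ae_abs_ditherError_le hΔ).mono fun t ht => ht (a i) i)
    (fun i => integral_ditherError_eval hΔ (a i) i) hv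
  refine (integral_pow_four_le_of_hasSubgaussianMGF hsub ?_).trans_eq ?_
  · exact pow_pos (show (0 : ℝ) < 3 / 2 * Δ by positivity) 2
  · change 96 * ((3 / 2 * Δ) ^ 2) ^ 2 = _
    ring

end SubGaussian

section QuantizedLaw

variable {d : ℕ} {Δ M r : ℝ} {P : Measure (Fin d → ℝ)}

/-- The law of `𝒬(y + τ)` for a random vector `y` with law `P` and an independent triangular dither
`τ`. -/
noncomputable def quantizedLaw (Δ : ℝ) (P : Measure (Fin d → ℝ)) : Measure (Fin d → ℝ) :=
  (P.prod (triangularDither d Δ)).map fun z i => quantize Δ (z.1 i + z.2 i)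

lemma measurable_quantize_add (d : ℕ) (Δ : ℝ) :
    Measurable fun (z : (Fin d → ℝ) × (Fin d → ℝ)) i => quantize Δ (z.1 i + z.2 i) :=
  measurable_pi_iff.2 fun _ => by fun_prop

lemma measurable_ditherError_pi (d : ℕ) (Δ : ℝ) :
    Measurable fun (z : (Fin d → ℝ) × (Fin d → ℝ)) i => ditherError Δ (z.1 i) (z.2 i) :=
  measurable_pi_iff.2 fun _ => by unfold ditherError; fun_prop

lemma quantize_add_eq_add_ditherError (Δ a t : ℝ) : quantize Δ (a + t) = a + ditherError Δ a t := by
  unfold ditherError; ring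

lemma ae_prod_abs_ditherError_le (hΔ : 0 < Δ) (P : Measure (Fin d → ℝ)) :
    ∀ᵐ z ∂P.prod (triangularDither d Δ), ∀ i, |ditherError Δ (z.1 i) (z.2 i)| ≤ 3 / 2 * Δ := by
  have := isProbabilityMeasure_triangularDither d hΔ
  exact (Measure.quasiMeasurePreserving_snd.ae (ae_abs_ditherError_le hΔ)).mono
    fun z hz i => hz (z.1 i) i

lemma ae_quantizedLaw_dotProduct_self_le (hΔ : 0 < Δ) (hr : ∀ᵐ y ∂P, y ⬝ᵥ y ≤ r) :
    ∀ᵐ y ∂quantizedLaw Δ P, y ⬝ᵥ y ≤ 2 * r + 9 / 2 * (d * Δ ^ 2) := by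
  have := isProbabilityMeasure_triangularDither d hΔ
  rw [quantizedLaw, ae_map_iff (measurable_quantize_add d Δ).aemeasurable
    (measurableSet_le (by unfold dotProduct; fun_prop) measurable_const)]
  filter_upwards [Measure.quasiMeasurePreserving_fst.ae hr, ae_prod_abs_ditherError_le hΔ P]
    with z hz herr
  have hcoord (i : Fin d) : quantize Δ (z.1 i + z.2 i) * quantize Δ (z.1 i + z.2 i) ≤
      2 * (z.1 i * z.1 i) + 9 / 2 * Δ ^ 2 := by
    have := sq_le_sq' (abs_le.1 (herr i)).1 (abs_le.1 (herr i)).2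
    rw [quantize_add_eq_add_ditherError]
    nlinarith [sq_nonneg (z.1 i - ditherError Δ (z.1 i) (z.2 i))]
  calc ∑ i, quantize Δ (z.1 i + z.2 i) * quantize Δ (z.1 i + z.2 i)
      ≤ ∑ i, (2 * (z.1 i * z.1 i) + 9 / 2 * Δ ^ 2) := Finset.sum_le_sum fun i _ => hcoord i
    _ = 2 * (z.1 ⬝ᵥ z.1) + 9 / 2 * (d * Δ ^ 2) := by
        rw [Finset.sum_add_distrib, ← Finset.mul_sum, Finset.sum_const, Finset.card_univ,
          Fintype.card_fin, nsmul_eq_mul, dotProduct]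
        ring
    _ ≤ 2 * r + 9 / 2 * (d * Δ ^ 2) := by gcongr

variable [IsProbabilityMeasure P]

lemma isProbabilityMeasure_quantizedLaw (hΔ : 0 < Δ) : IsProbabilityMeasure (quantizedLaw Δ P) := by
  have := isProbabilityMeasure_triangularDither d hΔ
  exact Measure.isProbabilityMeasure_map (measurable_quantize_add d Δ).aemeasurable

lemma memLp_quantize_add (hΔ : 0 < Δ) (hP : ∀ i, MemLp (fun y => y i) 2 P) (i : Fin d) :
    MemLp (fun z => quantize Δ (z.1 i + z.2 i)) 2 (P.prod (triangularDither d Δ)) := by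
  have := isProbabilityMeasure_triangularDither d hΔ
  have herr : MemLp (fun z => ditherError Δ (z.1 i) (z.2 i)) 2
      (P.prod (triangularDither d Δ)) :=
    .of_bound (Measurable.aestronglyMeasurable (by unfold ditherError; fun_prop)) (3 / 2 * Δ) <|
      (ae_prod_abs_ditherError_le hΔ P).mono fun z hz => hz i
  simp only [quantize_add_eq_add_ditherError]
  exact ((hP i).comp_fst _).add herr

lemma secondMoment_quantizedLaw (hΔ : 0 < Δ) (hP : ∀ i, MemLp (fun y => y i) 2 P) :
    secondMoment (quantizedLaw Δ P) = secondMoment P + (Δ ^ 2 / 4) • 1 := by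
  have := isProbabilityMeasure_triangularDither d hΔ
  ext i j
  have hint : Integrable (fun z => quantize Δ (z.1 i + z.2 i) * quantize Δ (z.1 j + z.2 j))
      (P.prod (triangularDither d Δ)) :=
    (memLp_quantize_add hΔ hP i).integrable_mul (memLp_quantize_add hΔ hP j)
  simp only [secondMoment, quantizedLaw, Matrix.of_apply, Matrix.add_apply, Matrix.smul_apply,
    Matrix.one_apply, smul_eq_mul, mul_ite, mul_one, mul_zero]
  rw [integral_map (measurable_quantize_add d Δ).aemeasurable
    (Measurable.aestronglyMeasurable (by fun_prop)), integral_prod _ hint]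
  simp only [integral_quantize_mul_quantize hΔ]
  have hmul : Integrable (fun y => y i * y j) P := (hP i).integrable_mul (hP j)
  rw [integral_add hmul (integrable_const _)]
  simp

lemma hasFourthMomentBound_map_ditherError (hΔ : 0 < Δ) :
    HasFourthMomentBound ((P.prod (triangularDither d Δ)).map
      fun z i => ditherError Δ (z.1 i) (z.2 i)) (486 * Δ ^ 4) := by
  have := isProbabilityMeasure_triangularDither d hΔ
  refine (hasFourthMomentBound_map_iff (measurable_ditherError_pi d Δ)).2 fun v hv => ?_
  have hint : Integrable (fun z => |v ⬝ᵥ fun i => ditherError Δ (z.1 i) (z.2 i)| ^ 4)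
      (P.prod (triangularDither d Δ)) := by
    refine .of_bound (Measurable.aestronglyMeasurable (by unfold dotProduct ditherError; fun_prop))
      ((∑ i, |v i| * (3 / 2 * Δ)) ^ 4) ?_
    filter_upwards [ae_prod_abs_ditherError_le hΔ P] with z hz
    rw [norm_pow, Real.norm_eq_abs, abs_abs]
    gcongr
    refine (Finset.abs_sum_le_sum_abs _ _).trans (Finset.sum_le_sum fun i _ => ?_)
    rw [abs_mul]
    gcongr
    exact hz i
  refine ⟨hint, ?_⟩
  rw [integral_prod _ hint]
  refine (integral_mono (g := fun _ => 486 * Δ ^ 4) hint.integral_prod_left (integrable_const _)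
    fun a => ?_).trans_eq (by simp)
  simpa only [Even.pow_abs (by decide : Even 4)] using
    integral_dotProduct_ditherError_pow_four_le hΔ a hv

lemma HasFourthMomentBound.quantizedLaw (hP : HasFourthMomentBound P M) (hΔ : 0 < Δ) :
    HasFourthMomentBound (quantizedLaw Δ P) (8 * (M + 486 * Δ ^ 4)) := by
  have := isProbabilityMeasure_triangularDither d hΔ
  have hfst : HasFourthMomentBound ((P.prod (triangularDither d Δ)).map Prod.fst) M := by
    rwa [Measure.map_fst_prod, measure_univ, one_smul]
  have hadd : (fun (z : (Fin d → ℝ) × (Fin d → ℝ)) i => quantize Δ (z.1 i + z.2 i)) =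
      Prod.fst + fun z i => ditherError Δ (z.1 i) (z.2 i) :=
    funext₂ fun _ _ => quantize_add_eq_add_ditherError _ _ _
  rw [QCE.quantizedLaw, hadd]
  exact hfst.map_add measurable_fst (measurable_ditherError_pi d Δ)
    (hasFourthMomentBound_map_ditherError hΔ)

end QuantizedLaw

section Truncation

variable {d : ℕ} {ζ M : ℝ} {P : Measure (Fin d → ℝ)}

lemma l4norm_nonneg (x : Fin d → ℝ) : 0 ≤ l4norm x :=
  Real.rpow_nonneg (Finset.sum_nonneg fun _ _ => by positivity) _

lemma l4norm_pow_four (x : Fin d → ℝ) : l4norm x ^ 4 = ∑ i, |x i| ^ 4 := by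
  rw [l4norm, ← Real.rpow_mul_natCast (Finset.sum_nonneg fun _ _ => by positivity)]
  norm_num

lemma l4norm_eq_zero {x : Fin d → ℝ} : l4norm x = 0 ↔ x = 0 := by
  rw [← pow_eq_zero_iff (four_ne_zero), l4norm_pow_four,
    Finset.sum_eq_zero_iff_of_nonneg fun _ _ => by positivity]
  simp [funext_iff]

lemma l4norm_smul (c : ℝ) (x : Fin d → ℝ) : l4norm (c • x) = |c| * l4norm x := by
  refine (pow_left_inj₀ (l4norm_nonneg _) (mul_nonneg (abs_nonneg c) (l4norm_nonneg x))
    four_ne_zero).1 ?_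
  simp only [mul_pow, l4norm_pow_four, Pi.smul_apply, smul_eq_mul, abs_mul, Finset.mul_sum]

lemma dotProduct_self_le_sqrt_mul_l4norm_sq (x : Fin d → ℝ) : x ⬝ᵥ x ≤ √d * l4norm x ^ 2 := by
  refine abs_le_of_sq_le_sq' ?_ (by positivity) |>.2
  calc (x ⬝ᵥ x) ^ 2 ≤ d * ∑ i, (x i * x i) ^ 2 := by
        simpa [dotProduct] using
          sq_sum_le_card_mul_sum_sq (s := Finset.univ) (f := fun i => x i * x i)
    _ = d * ∑ i, |x i| ^ 4 := by
        congr! 2 with i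
        rw [Even.pow_abs (by decide)]
        ring
    _ = (√d * l4norm x ^ 2) ^ 2 := by
        rw [mul_pow, Real.sq_sqrt d.cast_nonneg, ← pow_mul, ← l4norm_pow_four]

lemma measurable_truncate (ζ : ℝ) : Measurable (truncate ζ : (Fin d → ℝ) → Fin d → ℝ) := by
  unfold truncate l4norm
  fun_prop

lemma truncate_eq_self {x : Fin d → ℝ} (h : l4norm x ≤ ζ) : truncate ζ x = x := by
  rw [truncate, min_eq_left h]
  rcases eq_or_ne (l4norm x) 0 with h0 | h0
  · rw [l4norm_eq_zero.1 h0, smul_zero]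
  · rw [div_self h0, one_smul]

lemma truncate_factor_nonneg (hζ : 0 ≤ ζ) (x : Fin d → ℝ) : 0 ≤ min (l4norm x) ζ / l4norm x :=
  div_nonneg (le_min (l4norm_nonneg x) hζ) (l4norm_nonneg x)

lemma l4norm_truncate_le (hζ : 0 ≤ ζ) (x : Fin d → ℝ) : l4norm (truncate ζ x) ≤ ζ := by
  rw [truncate, l4norm_smul, abs_of_nonneg (truncate_factor_nonneg hζ x)]
  rcases eq_or_ne (l4norm x) 0 with h | h
  · rwa [h, mul_zero]
  · rw [div_mul_cancel₀ _ h]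
    exact min_le_right _ _

lemma truncate_dotProduct_self_le (hζ : 0 ≤ ζ) (x : Fin d → ℝ) :
    truncate ζ x ⬝ᵥ truncate ζ x ≤ √d * ζ ^ 2 := by
  refine (dotProduct_self_le_sqrt_mul_l4norm_sq _).trans ?_
  gcongr
  · exact l4norm_nonneg _
  · exact l4norm_truncate_le hζ x

lemma abs_dotProduct_truncate_le (hζ : 0 ≤ ζ) (v x : Fin d → ℝ) :
    |v ⬝ᵥ truncate ζ x| ≤ |v ⬝ᵥ x| := by
  rw [truncate, dotProduct_smul, smul_eq_mul, abs_mul, abs_of_nonneg (truncate_factor_nonneg hζ x)]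
  exact mul_le_of_le_one_left (abs_nonneg _)
    (div_le_one_of_le₀ (min_le_left _ _) (l4norm_nonneg x))

/-- Truncation acts only where `‖x‖₄ > ζ`, so the left side is at most `(vᵀx)² ‖x‖₄² / ζ²`; the free
parameter `s` comes from the arithmetic-geometric mean inequality. -/
lemma abs_sq_dotProduct_truncate_sub_le (hζ : 0 < ζ) {s : ℝ} (hs : 0 < s) (v x : Fin d → ℝ) :
    |(v ⬝ᵥ truncate ζ x) ^ 2 - (v ⬝ᵥ x) ^ 2| ≤
      (2 * ζ ^ 2)⁻¹ * (s * |v ⬝ᵥ x| ^ 4 + s⁻¹ * ∑ i, |x i| ^ 4) := by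
  rw [← l4norm_pow_four, Even.pow_abs (by decide : Even 4)]
  rcases le_or_gt (l4norm x) ζ with h | h
  · rw [truncate_eq_self h, sub_self, abs_zero]
    positivity
  have hle : (v ⬝ᵥ truncate ζ x) ^ 2 ≤ (v ⬝ᵥ x) ^ 2 :=
    sq_le_sq.2 (abs_dotProduct_truncate_le hζ.le v x)
  have hamgm : 2 * ((v ⬝ᵥ x) ^ 2 * l4norm x ^ 2) ≤ s * (v ⬝ᵥ x) ^ 4 + s⁻¹ * l4norm x ^ 4 := by
    have hsq : s * (v ⬝ᵥ x) ^ 4 + s⁻¹ * l4norm x ^ 4 - 2 * ((v ⬝ᵥ x) ^ 2 * l4norm x ^ 2) =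
        s⁻¹ * (s * (v ⬝ᵥ x) ^ 2 - l4norm x ^ 2) ^ 2 := by field_simp; ring
    have : 0 ≤ s⁻¹ * (s * (v ⬝ᵥ x) ^ 2 - l4norm x ^ 2) ^ 2 := by positivity
    linarith
  calc |(v ⬝ᵥ truncate ζ x) ^ 2 - (v ⬝ᵥ x) ^ 2| ≤ (v ⬝ᵥ x) ^ 2 := by
        rw [abs_sub_comm, abs_of_nonneg (sub_nonneg.2 hle)]
        exact sub_le_self _ (sq_nonneg _)
    _ ≤ (2 * ζ ^ 2)⁻¹ * (2 * ((v ⬝ᵥ x) ^ 2 * l4norm x ^ 2)) := by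
        rw [inv_mul_eq_div, le_div_iff₀ (by positivity)]
        nlinarith [mul_le_mul_of_nonneg_left (pow_le_pow_left₀ hζ.le h.le 2) (sq_nonneg (v ⬝ᵥ x))]
    _ ≤ _ := by gcongr

lemma HasFourthMomentBound.map_truncate (hP : HasFourthMomentBound P M) (hζ : 0 ≤ ζ) :
    HasFourthMomentBound (P.map (truncate ζ)) M := by
  refine (hasFourthMomentBound_map_iff (measurable_truncate ζ)).2 fun v hv => ?_
  obtain ⟨hint, hle⟩ := hP v hv
  have hpoint (x : Fin d → ℝ) : |v ⬝ᵥ truncate ζ x| ^ 4 ≤ |v ⬝ᵥ x| ^ 4 := by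
    exact pow_le_pow_left₀ (abs_nonneg _) (abs_dotProduct_truncate_le hζ v x) 4
  have hmeas : Measurable fun x => |v ⬝ᵥ truncate ζ x| ^ 4 := by
    have := measurable_truncate (d := d) ζ
    unfold dotProduct
    fun_prop
  have hint' : Integrable (fun x => |v ⬝ᵥ truncate ζ x| ^ 4) P :=
    hint.mono' hmeas.aestronglyMeasurable (ae_of_all _ fun x => by
      rw [norm_pow, Real.norm_eq_abs, abs_abs]
      exact hpoint x)
  exact ⟨hint', (integral_mono hint' hint hpoint).trans hle⟩

lemma ae_map_truncate_dotProduct_self_le (hζ : 0 ≤ ζ) :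
    ∀ᵐ y ∂P.map (truncate ζ), y ⬝ᵥ y ≤ √d * ζ ^ 2 := by
  rw [ae_map_iff (measurable_truncate ζ).aemeasurable
    (measurableSet_le (by unfold dotProduct; fun_prop) measurable_const)]
  exact ae_of_all _ (truncate_dotProduct_self_le hζ)

variable [IsProbabilityMeasure P]

lemma isProbabilityMeasure_map_truncate (ζ : ℝ) : IsProbabilityMeasure (P.map (truncate ζ)) :=
  Measure.isProbabilityMeasure_map (measurable_truncate ζ).aemeasurable

lemma integrable_dotProduct_truncate_sq (hP : HasFourthMomentBound P M) (hζ : 0 ≤ ζ)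
    (v : Fin d → ℝ) : Integrable (fun x => (v ⬝ᵥ truncate ζ x) ^ 2) P := by
  have := isProbabilityMeasure_map_truncate (P := P) ζ
  exact (integrable_dotProduct_sq (hP.map_truncate hζ).memLp_eval v).comp_measurable
    (measurable_truncate ζ)

lemma dotProduct_secondMoment_map_truncate_sub_mulVec (hP : HasFourthMomentBound P M)
    (hζ : 0 ≤ ζ) (v : Fin d → ℝ) :
    v ⬝ᵥ (secondMoment (P.map (truncate ζ)) - secondMoment P) *ᵥ v =
      ∫ x, ((v ⬝ᵥ truncate ζ x) ^ 2 - (v ⬝ᵥ x) ^ 2) ∂P := by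
  have := isProbabilityMeasure_map_truncate (P := P) ζ
  rw [Matrix.sub_mulVec, dotProduct_sub,
    dotProduct_secondMoment_mulVec (hP.map_truncate hζ).memLp_eval,
    dotProduct_secondMoment_mulVec hP.memLp_eval,
    integral_map (measurable_truncate ζ).aemeasurable
      (Measurable.aestronglyMeasurable (by unfold dotProduct; fun_prop)),
    integral_sub (integrable_dotProduct_truncate_sq hP hζ v)
      (integrable_dotProduct_sq hP.memLp_eval v)]

/-- The value `s = √d` balances the two moments `E |vᵀx|⁴ ≤ M` and `E ‖x‖₄⁴ ≤ d M`. -/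
lemma norm_secondMoment_map_truncate_sub_le (hP : HasFourthMomentBound P M) (hd : 0 < d)
    (hζ : 0 < ζ) :
    ‖secondMoment (P.map (truncate ζ)) - secondMoment P‖ ≤ M * √d / ζ ^ 2 := by
  have hM : 0 ≤ M := hP.nonneg ⟨0, hd⟩
  have hs : 0 < √(d : ℝ) := by positivity
  have hsymm := (isHermitian_secondMoment (P.map (truncate ζ))).sub (isHermitian_secondMoment P)
  refine norm_le_of_abs_dotProduct_mulVec_le hsymm (by positivity) fun v hv => ?_
  have hfirst := (hP v hv).1.const_mul √d
  have hsecond := hP.integrable_sum.const_mul (√d)⁻¹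
  rw [dotProduct_secondMoment_map_truncate_sub_mulVec hP hζ.le]
  calc |∫ x, ((v ⬝ᵥ truncate ζ x) ^ 2 - (v ⬝ᵥ x) ^ 2) ∂P|
      ≤ ∫ x, |(v ⬝ᵥ truncate ζ x) ^ 2 - (v ⬝ᵥ x) ^ 2| ∂P := abs_integral_le_integral_abs
    _ ≤ ∫ x, (2 * ζ ^ 2)⁻¹ * (√d * |v ⬝ᵥ x| ^ 4 + (√d)⁻¹ * ∑ i, |x i| ^ 4) ∂P :=
        integral_mono ((integrable_dotProduct_truncate_sq hP hζ.le v).sub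
          (integrable_dotProduct_sq hP.memLp_eval v)).abs ((hfirst.add hsecond).const_mul _)
          (abs_sq_dotProduct_truncate_sub_le hζ hs v)
    _ = (2 * ζ ^ 2)⁻¹ *
          (√d * ∫ x, |v ⬝ᵥ x| ^ 4 ∂P + (√d)⁻¹ * ∫ x, ∑ i, |x i| ^ 4 ∂P) := by
        rw [integral_const_mul, integral_add hfirst hsecond, integral_const_mul,
          integral_const_mul]
    _ ≤ (2 * ζ ^ 2)⁻¹ * (√d * M + (√d)⁻¹ * (d * M)) := by
        gcongr
        · exact (hP v hv).2
        · exact hP.integral_sum_le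
    _ = M * √d / ζ ^ 2 := by
        have : (√d)⁻¹ * d = √d := by rw [inv_mul_eq_div, Real.div_sqrt]
        rw [← mul_assoc (√d)⁻¹, this]
        ring

end Truncation

section SampleSecondMoment

lemma dotProduct_sq_le_of_dotProduct_self_eq_one {m : Type*} [Fintype m] {v : m → ℝ}
    (hv : v ⬝ᵥ v = 1) (y : m → ℝ) : (v ⬝ᵥ y) ^ 2 ≤ y ⬝ᵥ y := by
  have h := Finset.sum_mul_sq_le_sq_mul_sq Finset.univ v y
  simp only [pow_two (v _), pow_two (y _)] at h
  rwa [← dotProduct, ← dotProduct, ← dotProduct, hv, one_mul] at h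

lemma norm_vecMulVec_self_le {d : ℕ} (y : Fin d → ℝ) : ‖Matrix.vecMulVec y y‖ ≤ y ⬝ᵥ y := by
  have hy : 0 ≤ y ⬝ᵥ y := Finset.sum_nonneg fun i _ => mul_self_nonneg _
  refine norm_le_of_abs_dotProduct_mulVec_le (isHermitian_vecMulVec_self y) hy fun v hv => ?_
  rw [dotProduct_vecMulVec_mulVec, abs_of_nonneg (sq_nonneg _)]
  exact dotProduct_sq_le_of_dotProduct_self_eq_one hv y

variable {d : ℕ} {Q : Measure (Fin d → ℝ)} {K L : ℝ}

/-- The matrix `y yᵀ - E (y yᵀ)` for a random vector `y` with law `Q`. -/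
noncomputable def centeredOuter (Q : Measure (Fin d → ℝ)) (y : Fin d → ℝ) :
    Matrix (Fin d) (Fin d) ℝ :=
  Matrix.vecMulVec y y - secondMoment Q

lemma isHermitian_centeredOuter (Q : Measure (Fin d → ℝ)) (y : Fin d → ℝ) :
    (centeredOuter Q y).IsHermitian :=
  (isHermitian_vecMulVec_self y).sub (isHermitian_secondMoment Q)

lemma HasFourthMomentBound.integrable_vecMulVec_self_sq (hQ : HasFourthMomentBound Q K) :
    Integrable (fun y => Matrix.vecMulVec y y ^ 2) Q := by
  refine (hQ.integrable_sum.const_mul d).mono' ?_ (ae_of_all _ fun y => ?_)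
  · exact Continuous.aestronglyMeasurable (by fun_prop)
  calc ‖Matrix.vecMulVec y y ^ 2‖ ≤ ‖Matrix.vecMulVec y y‖ ^ 2 := norm_pow_le' _ two_pos
    _ ≤ (√d * l4norm y ^ 2) ^ 2 := by
        gcongr
        exact (norm_vecMulVec_self_le y).trans (dotProduct_self_le_sqrt_mul_l4norm_sq y)
    _ = d * ∑ i, |y i| ^ 4 := by
        rw [mul_pow, Real.sq_sqrt d.cast_nonneg, ← pow_mul, ← l4norm_pow_four]

lemma isHermitian_integral_vecMulVec_self_sq (Q : Measure (Fin d → ℝ)) :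
    (∫ y, Matrix.vecMulVec y y ^ 2 ∂Q).IsHermitian :=
  (Matrix.nonneg_iff_posSemidef.1 <| integral_nonneg fun y =>
    (isHermitian_vecMulVec_self y).isSelfAdjoint.sq_nonneg).isHermitian

/-- Tested on a unit vector `v`, the left side is
`E (∑ yᵢ²) (vᵀy)² ≤ ½ ∑ (E yᵢ⁴ + E (vᵀy)⁴) ≤ d K`. -/
lemma HasFourthMomentBound.integral_vecMulVec_self_sq_le (hQ : HasFourthMomentBound Q K) :
    ∫ y, Matrix.vecMulVec y y ^ 2 ∂Q ≤ (d * K) • (1 : Matrix (Fin d) (Fin d) ℝ) := by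
  refine le_smul_one_of_dotProduct_mulVec_le (isHermitian_integral_vecMulVec_self_sq Q)
    fun v hv => ?_
  have hpoint (y : Fin d → ℝ) : v ⬝ᵥ Matrix.vecMulVec y y ^ 2 *ᵥ v ≤
      2⁻¹ * (∑ i, |y i| ^ 4 + d * |v ⬝ᵥ y| ^ 4) := by
    have hterm (i : Fin d) : y i * y i * (v ⬝ᵥ y) ^ 2 ≤ 2⁻¹ * (|y i| ^ 4 + |v ⬝ᵥ y| ^ 4) := by
      rw [Even.pow_abs (by decide), Even.pow_abs (by decide)]
      nlinarith [sq_nonneg (y i ^ 2 - (v ⬝ᵥ y) ^ 2)]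
    rw [vecMulVec_self_sq, Matrix.smul_mulVec, dotProduct_smul, dotProduct_vecMulVec_mulVec,
      smul_eq_mul, dotProduct, Finset.sum_mul]
    refine (Finset.sum_le_sum fun i _ => hterm i).trans_eq ?_
    rw [← Finset.mul_sum, Finset.sum_add_distrib, Finset.sum_const, Finset.card_univ,
      Fintype.card_fin, nsmul_eq_mul]
  obtain ⟨hint, hle⟩ := hQ v hv
  rw [← integral_dotProduct_mulVec hQ.integrable_vecMulVec_self_sq]
  calc ∫ y, v ⬝ᵥ Matrix.vecMulVec y y ^ 2 *ᵥ v ∂Q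
      ≤ ∫ y, 2⁻¹ * (∑ i, |y i| ^ 4 + d * |v ⬝ᵥ y| ^ 4) ∂Q :=
        integral_mono (integrable_dotProduct_mulVec hQ.integrable_vecMulVec_self_sq v v)
          ((hQ.integrable_sum.add (hint.const_mul _)).const_mul _) hpoint
    _ = 2⁻¹ * (∫ y, ∑ i, |y i| ^ 4 ∂Q + d * ∫ y, |v ⬝ᵥ y| ^ 4 ∂Q) := by
        rw [integral_const_mul, integral_add hQ.integrable_sum (hint.const_mul _),
          integral_const_mul]
    _ ≤ 2⁻¹ * (d * K + d * K) := by
        gcongr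
        exact hQ.integral_sum_le
    _ = d * K := by ring

variable [IsProbabilityMeasure Q]

lemma integral_centeredOuter (hQ : ∀ i, MemLp (fun y => y i) 2 Q) :
    ∫ y, centeredOuter Q y ∂Q = 0 := by
  simp only [centeredOuter]
  rw [integral_sub (integrable_vecMulVec_self hQ) (integrable_const _), integral_vecMulVec_self hQ]
  simp

lemma ae_norm_centeredOuter_le (hQ : ∀ i, MemLp (fun y => y i) 2 Q)
    (hL : ∀ᵐ y ∂Q, y ⬝ᵥ y ≤ L) : ∀ᵐ y ∂Q, ‖centeredOuter Q y‖ ≤ L := by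
  have hmean {v : Fin d → ℝ} (hv : v ⬝ᵥ v = 1) : ∫ y, (v ⬝ᵥ y) ^ 2 ∂Q ≤ L := by
    refine (integral_mono_ae (g := fun _ => L) (integrable_dotProduct_sq hQ v)
      (integrable_const _) ?_).trans_eq (by simp)
    filter_upwards [hL] with y hy
    exact (dotProduct_sq_le_of_dotProduct_self_eq_one hv y).trans hy
  filter_upwards [hL] with y hy
  have hL0 : 0 ≤ L := (Finset.sum_nonneg fun i _ => mul_self_nonneg _).trans hy
  refine norm_le_of_abs_dotProduct_mulVec_le (isHermitian_centeredOuter Q y) hL0 fun v hv => ?_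
  rw [centeredOuter, Matrix.sub_mulVec, dotProduct_sub, dotProduct_vecMulVec_mulVec,
    dotProduct_secondMoment_mulVec hQ]
  exact abs_sub_le_of_nonneg_of_le (sq_nonneg _)
    ((dotProduct_sq_le_of_dotProduct_self_eq_one hv y).trans hy)
    (integral_nonneg fun _ => sq_nonneg _) (hmean hv)

lemma integral_centeredOuter_sq_eq (hQ : HasFourthMomentBound Q K) :
    ∫ y, centeredOuter Q y ^ 2 ∂Q =
      ∫ y, Matrix.vecMulVec y y ^ 2 ∂Q - secondMoment Q ^ 2 := by
  have hY := integrable_vecMulVec_self hQ.memLp_eval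
  have hleft : Integrable (fun y => Matrix.vecMulVec y y * secondMoment Q) Q := hY.mul_const _
  have hright : Integrable (fun y => secondMoment Q * Matrix.vecMulVec y y) Q := hY.const_mul _
  have hexpand (y : Fin d → ℝ) : centeredOuter Q y ^ 2 = Matrix.vecMulVec y y ^ 2 -
      Matrix.vecMulVec y y * secondMoment Q - secondMoment Q * Matrix.vecMulVec y y +
      secondMoment Q ^ 2 := by
    rw [centeredOuter]; noncomm_ring
  have hsq := hQ.integrable_vecMulVec_self_sq
  simp only [hexpand]
  rw [integral_add (by exact (hsq.sub hleft).sub hright) (integrable_const _),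
    integral_sub (by exact hsq.sub hleft) hright, integral_sub hsq hleft,
    integral_mul_const_of_integrable hY, integral_const_mul_of_integrable hY,
    integral_vecMulVec_self hQ.memLp_eval, integral_const, probReal_univ, one_smul]
  noncomm_ring

lemma HasFourthMomentBound.integral_centeredOuter_sq_le (hQ : HasFourthMomentBound Q K) :
    ∫ y, centeredOuter Q y ^ 2 ∂Q ≤ (d * K) • (1 : Matrix (Fin d) (Fin d) ℝ) := by
  rw [integral_centeredOuter_sq_eq hQ]
  exact (sub_le_self _ (isHermitian_secondMoment Q).isSelfAdjoint.sq_nonneg).trans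
    hQ.integral_vecMulVec_self_sq_le

theorem measureReal_le_norm_sum_centeredOuter_le (hQ : HasFourthMomentBound Q K)
    (hd : 0 < d) (hL : ∀ᵐ y ∂Q, y ⬝ᵥ y ≤ L) {ι Ω : Type*} [Fintype ι] [MeasurableSpace Ω]
    {μ : Measure Ω} {ξ : ι → Ω → Fin d → ℝ} (hindep : iIndepFun ξ μ)
    (hlaw : ∀ k, HasLaw (ξ k) Q μ) {θ : ℝ} (hθ : 0 < θ) (hθL : θ * L ≤ 1) (t : ℝ) :
    μ.real {ω | t ≤ ‖∑ k, centeredOuter Q (ξ k ω)‖} ≤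
      2 * d * Real.exp (Fintype.card ι * (θ ^ 2 * (d * K)) - θ * t) := by
  borelize (Matrix (Fin d) (Fin d) ℝ)
  have := hindep.isProbabilityMeasure
  have : Nonempty (Fin d) := ⟨⟨0, hd⟩⟩
  have hK : 0 ≤ K := hQ.nonneg ⟨0, hd⟩
  have hcont : Continuous (centeredOuter Q) := by unfold centeredOuter; fun_prop
  have htransfer (k : ι) {f : (Fin d → ℝ) → Matrix (Fin d) (Fin d) ℝ} (hf : Continuous f) :
      ∫ ω, f (ξ k ω) ∂μ = ∫ y, f y ∂Q := (hlaw k).integral_comp hf.aestronglyMeasurable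
  have hbound (k : ι) : ∀ᵐ ω ∂μ, ‖centeredOuter Q (ξ k ω)‖ ≤ L :=
    ae_of_ae_map (hlaw k).aemeasurable <| by
      rw [(hlaw k).map_eq]
      exact ae_norm_centeredOuter_le hQ.memLp_eval hL
  have hmean (k : ι) : ∫ ω, centeredOuter Q (ξ k ω) ∂μ = 0 :=
    (htransfer k hcont).trans (integral_centeredOuter hQ.memLp_eval)
  have hvar (k : ι) : ∫ ω, centeredOuter Q (ξ k ω) ^ 2 ∂μ ≤ (d * K) • 1 :=
    (htransfer k (hcont.pow 2)).trans_le hQ.integral_centeredOuter_sq_le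
  have h := measureReal_le_norm_sum_le_of_norm_le (by positivity)
    (hindep.comp (fun _ => centeredOuter Q) fun _ => hcont.measurable)
    (fun k => hcont.measurable.comp_aemeasurable (hlaw k).aemeasurable)
    (fun k ω => isHermitian_centeredOuter Q _) hbound hmean hvar hθ hθL t
  rwa [Fintype.card_fin] at h

end SampleSecondMoment

section EstimatorBound

lemma iIndepFun_prodMk_of_sumElim {ι Ω F : Type*} [Finite ι] [MeasurableSpace Ω]
    [MeasurableSpace F] {μ : Measure Ω} {x y : ι → Ω → F} (hx : ∀ k, AEMeasurable (x k) μ)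
    (hy : ∀ k, AEMeasurable (y k) μ) (hindep : iIndepFun (Sum.elim x y) μ) :
    iIndepFun (fun k ω => (x k ω, y k ω)) μ := by
  cases nonempty_fintype ι
  have := hindep.isProbabilityMeasure
  have hxy (k : ι ⊕ ι) : AEMeasurable (Sum.elim x y k) μ := k.casesOn hx hy
  have (k : ι ⊕ ι) : IsProbabilityMeasure (μ.map (Sum.elim x y k)) :=
    Measure.isProbabilityMeasure_map (hxy k)
  have (k : ι) : IsProbabilityMeasure (μ.map (x k)) := Measure.isProbabilityMeasure_map (hx k)
  have (k : ι) : IsProbabilityMeasure (μ.map (y k)) := Measure.isProbabilityMeasure_map (hy k)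
  have hpair (k : ι) : μ.map (fun ω => (x k ω, y k ω)) = (μ.map (x k)).prod (μ.map (y k)) :=
    (hindep.indepFun (i := .inl k) (j := .inr k) (by simp)).map_prod_eq_prod_map_map (hx k) (hy k)
  have hregroup := (measurePreserving_arrowProdEquivProdArrow F F ι
      (fun k => μ.map (x k)) (fun k => μ.map (y k))).symm.comp
    (measurePreserving_sumPiEquivProdPi_symm
      (X := fun _ : ι ⊕ ι => F) (fun k => μ.map (Sum.elim x y k))).symm
  have hjoint : HasLaw (fun ω k => Sum.elim x y k ω)
      (Measure.pi fun k => μ.map (Sum.elim x y k)) μ :=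
    ⟨aemeasurable_pi_iff.2 hxy, (iIndepFun_iff_map_fun_eq_pi_map hxy).1 hindep⟩
  rw [iIndepFun_iff_map_fun_eq_pi_map fun k => (hx k).prodMk (hy k)]
  simp_rw [hpair]
  exact (hregroup.comp_hasLaw hjoint).map_eq

lemma opNorm_eq_norm {d : ℕ} (A : Matrix (Fin d) (Fin d) ℝ) : opNorm A = ‖A‖ :=
  Matrix.l2_opNorm_toEuclideanCLM A

variable {d n : ℕ} {P : Measure (Fin d → ℝ)} {Δ ζ : ℝ}

lemma measurable_quantizedSample (d : ℕ) (Δ ζ : ℝ) :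
    Measurable fun z : (Fin d → ℝ) × (Fin d → ℝ) => quantizedSample Δ ζ z.1 z.2 := by
  have := measurable_truncate (d := d) ζ
  unfold quantizedSample quantize
  fun_prop

lemma map_quantizedSample_prod [SFinite P] (hΔ : 0 < Δ) :
    (P.prod (triangularDither d Δ)).map (fun z => quantizedSample Δ ζ z.1 z.2) =
      quantizedLaw Δ (P.map (truncate ζ)) := by
  have := isProbabilityMeasure_triangularDither d hΔ
  have hprod : (P.map (truncate ζ)).prod (triangularDither d Δ) =
      (P.prod (triangularDither d Δ)).map (Prod.map (truncate ζ) id) := by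
    rw [← Measure.map_prod_map _ _ (measurable_truncate ζ) measurable_id, Measure.map_id]
  rw [quantizedLaw, hprod, Measure.map_map (measurable_quantize_add d Δ)
    ((measurable_truncate ζ).prodMap measurable_id)]
  rfl

lemma hasLaw_quantizedSample [IsProbabilityMeasure P] (hΔ : 0 < Δ) {Ω : Type*}
    [MeasurableSpace Ω] {μ : Measure Ω} {x τ : Ω → Fin d → ℝ} (hx : HasLaw x P μ)
    (hτ : HasLaw τ (triangularDither d Δ) μ) (hindep : IndepFun x τ μ) :
    HasLaw (fun ω => quantizedSample Δ ζ (x ω) (τ ω)) (quantizedLaw Δ (P.map (truncate ζ))) μ := by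
  have := hx.isProbabilityMeasure_iff.2 ‹_›
  have hsample : HasLaw (fun z => quantizedSample Δ ζ z.1 z.2)
      (quantizedLaw Δ (P.map (truncate ζ))) (P.prod (triangularDither d Δ)) :=
    ⟨(measurable_quantizedSample d Δ ζ).aemeasurable, map_quantizedSample_prod hΔ⟩
  exact (hsample.fun_comp (hindep.hasLaw_prod hx hτ) :)

lemma iIndepFun_quantizedSample {ι Ω : Type*} [Finite ι] [MeasurableSpace Ω] {μ : Measure Ω}
    {x τ : ι → Ω → Fin d → ℝ} (hx : ∀ k, AEMeasurable (x k) μ) (hτ : ∀ k, AEMeasurable (τ k) μ)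
    (hindep : iIndepFun (Sum.elim x τ) μ) :
    iIndepFun (fun k ω => quantizedSample Δ ζ (x k ω) (τ k ω)) μ :=
  (iIndepFun_prodMk_of_sumElim hx hτ hindep).comp (fun _ z => quantizedSample Δ ζ z.1 z.2)
    fun _ => measurable_quantizedSample d Δ ζ

variable [IsProbabilityMeasure P] {M : ℝ}

lemma estimator_sub_secondMoment_eq (hP : HasFourthMomentBound P M) (hΔ : 0 < Δ) (hζ : 0 ≤ ζ)
    (hn : n ≠ 0) (x τ : Fin n → Fin d → ℝ) :
    estimator Δ ζ x τ - secondMoment P =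
      (n : ℝ)⁻¹ • ∑ k, centeredOuter (quantizedLaw Δ (P.map (truncate ζ)))
        (quantizedSample Δ ζ (x k) (τ k)) +
      (secondMoment (P.map (truncate ζ)) - secondMoment P) := by
  have := isProbabilityMeasure_map_truncate (P := P) ζ
  simp only [estimator, centeredOuter]
  rw [Finset.sum_sub_distrib, Finset.sum_const, Finset.card_univ, Fintype.card_fin, smul_sub,
    ← Nat.cast_smul_eq_nsmul ℝ, inv_smul_smul₀ (Nat.cast_ne_zero.2 hn),
    secondMoment_quantizedLaw hΔ (hP.map_truncate hζ).memLp_eval, one_div]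
  abel

theorem measureReal_le_opNorm_estimator_sub_le (hP : HasFourthMomentBound P M) (hd : 0 < d)
    (hn : n ≠ 0) (hΔ : 0 < Δ) (hζ : 0 < ζ) {Ω : Type*} [MeasurableSpace Ω] {μ : Measure Ω}
    {x τ : Fin n → Ω → Fin d → ℝ} (hx : ∀ k, HasLaw (x k) P μ)
    (hτ : ∀ k, HasLaw (τ k) (triangularDither d Δ) μ) (hindep : iIndepFun (Sum.elim x τ) μ)
    {θ : ℝ} (hθ : 0 < θ) (hθL : θ * (2 * (√d * ζ ^ 2) + 9 / 2 * (d * Δ ^ 2)) ≤ 1) (s : ℝ) :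
    μ.real {ω | s ≤ opNorm (estimator Δ ζ (fun k => x k ω) (fun k => τ k ω) - secondMoment P)} ≤
      2 * d * Real.exp (n * (θ ^ 2 * (d * (8 * (M + 486 * Δ ^ 4)))) -
        θ * (n * (s - M * √d / ζ ^ 2))) := by
  have := hindep.isProbabilityMeasure
  have := isProbabilityMeasure_map_truncate (P := P) ζ
  have := isProbabilityMeasure_quantizedLaw (P := P.map (truncate ζ)) hΔ
  have hbernstein := measureReal_le_norm_sum_centeredOuter_le
    ((hP.map_truncate hζ.le).quantizedLaw hΔ) hd
    (ae_quantizedLaw_dotProduct_self_le hΔ (ae_map_truncate_dotProduct_self_le hζ.le))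
    (iIndepFun_quantizedSample (fun k => (hx k).aemeasurable) (fun k => (hτ k).aemeasurable) hindep)
    (fun k => hasLaw_quantizedSample (ζ := ζ) hΔ (hx k) (hτ k)
      (hindep.indepFun (i := .inl k) (j := .inr k) (by simp)))
    hθ hθL (n * (s - M * √d / ζ ^ 2))
  rw [Fintype.card_fin] at hbernstein
  refine (measureReal_mono fun ω (hω : s ≤ opNorm _) => ?_).trans hbernstein
  have hn' : (0 : ℝ) < n := by positivity
  rw [opNorm_eq_norm, estimator_sub_secondMoment_eq hP hΔ hζ.le hn] at hω
  have hbias := norm_secondMoment_map_truncate_sub_le hP hd hζ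
  have hdev := hω.trans (norm_add_le _ _)
  rw [norm_smul, Real.norm_of_nonneg (by positivity)] at hdev
  rw [Set.mem_ofPred_eq, ← le_inv_mul_iff₀ hn']
  linarith

end EstimatorBound

section ParameterChoice

lemma rpow_one_div_four_sq {t : ℝ} (ht : 0 ≤ t) : (t ^ ((1 : ℝ) / 4)) ^ 2 = √t := by
  rw [← Real.rpow_natCast, ← Real.rpow_mul ht, Real.sqrt_eq_rpow]
  norm_num

variable {c₀ c₁ c₂ d n D δ Δ M R t ρ ζ K κ b : ℝ}

lemma mul_sqrt_le_threshold_scale_sq (hM : 0 ≤ M) (hΔ : 0 ≤ Δ) (ht : 0 ≤ t) :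
    (√M + Δ ^ 2) * √t ≤ ((M ^ ((1 : ℝ) / 4) + Δ) * t ^ ((1 : ℝ) / 4)) ^ 2 := by
  rw [mul_pow, rpow_one_div_four_sq ht, ← rpow_one_div_four_sq hM]
  have : 0 ≤ M ^ ((1 : ℝ) / 4) * Δ := by positivity
  gcongr
  linarith

lemma threshold_scale_sq_le_mul_sqrt (hM : 0 ≤ M) (ht : 0 ≤ t) :
    ((M ^ ((1 : ℝ) / 4) + Δ) * t ^ ((1 : ℝ) / 4)) ^ 2 ≤ 2 * (√M + Δ ^ 2) * √t := by
  rw [mul_pow, rpow_one_div_four_sq ht, ← rpow_one_div_four_sq hM]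
  gcongr
  linarith [sq_nonneg (M ^ ((1 : ℝ) / 4) - Δ)]

lemma add_mul_pow_four_le (hM : 0 ≤ M) : M + 486 * Δ ^ 4 ≤ 486 * (√M + Δ ^ 2) ^ 2 := by
  have := mul_nonneg (Real.sqrt_nonneg M) (sq_nonneg Δ)
  nlinarith [Real.sq_sqrt hM]

lemma bias_le (hc₁ : 0 < c₁) (hR : 0 < R) (hMR : M ≤ R ^ 2) (ht : 0 < t)
    (htρ : √t * ρ = √d) (hζ : c₁ ^ 2 * (R * √t) ≤ ζ ^ 2) :
    M * √d / ζ ^ 2 ≤ 1 / c₁ ^ 2 * (R * ρ) := by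
  calc M * √d / ζ ^ 2 ≤ R ^ 2 * √d / (c₁ ^ 2 * (R * √t)) := by gcongr
    _ = 1 / c₁ ^ 2 * (R * ρ) := by rw [← htρ]; field_simp

/-- The constant `K` in the choice `θ = ρ / (K R d)` of the parameter of the exponential bound,
where `R = √M + Δ²` and `ρ = √(δ d log d / n)`. Its three summands control, in order, the
contribution of the truncated sample and of the quantization error to `θ` times the almost sure
bound, and the variance term. -/
noncomputable def temperatureConst (c₀ c₂ : ℝ) : ℝ := 4 * c₂ ^ 2 + 5 / √c₀ + 63

lemma le_temperatureConst (c₀ c₂ : ℝ) : 63 ≤ temperatureConst c₀ c₂ := by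
  have : 0 ≤ 4 * c₂ ^ 2 + 5 / √c₀ := by positivity
  unfold temperatureConst
  linarith

lemma temperature_mul_le_one (hc₀ : 0 < c₀) (hd : 0 < d) (hR : 0 < R) (hΔR : Δ ^ 2 ≤ R)
    (hρ : 0 ≤ ρ) (hρc₀ : √c₀ * ρ ≤ 1) (htρ : √t * ρ = √d) (hζ : ζ ^ 2 ≤ c₂ ^ 2 * (2 * R * √t)) :
    ρ / (temperatureConst c₀ c₂ * R * d) * (2 * (√d * ζ ^ 2) + 9 / 2 * (d * Δ ^ 2)) ≤ 1 := by
  have hK := le_temperatureConst c₀ c₂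
  have htruncated : ρ * (√d * ζ ^ 2) ≤ 2 * c₂ ^ 2 * (R * d) := by
    calc ρ * (√d * ζ ^ 2) ≤ ρ * (√d * (c₂ ^ 2 * (2 * R * √t))) := by gcongr
      _ = 2 * c₂ ^ 2 * R * (√d * (√t * ρ)) := by ring
      _ = 2 * c₂ ^ 2 * (R * d) := by rw [htρ, Real.mul_self_sqrt hd.le]; ring
  have hquantization : ρ * (d * Δ ^ 2) ≤ 1 / √c₀ * (R * d) := by
    have : ρ ≤ 1 / √c₀ := by rwa [le_div_iff₀ (Real.sqrt_pos.2 hc₀), mul_comm]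
    calc ρ * (d * Δ ^ 2) ≤ 1 / √c₀ * (d * R) := by gcongr
      _ = 1 / √c₀ * (R * d) := by ring
  have hsplit : temperatureConst c₀ c₂ * R * d =
      4 * c₂ ^ 2 * (R * d) + 5 * (1 / √c₀ * (R * d)) + 63 * (R * d) := by
    unfold temperatureConst; ring
  have hRd : 0 < R * d := mul_pos hR hd
  have : 0 ≤ 1 / √c₀ * (R * d) := by positivity
  rw [div_mul_eq_mul_div, div_le_one (by positivity)]
  linarith

lemma temperature_variance_le (hd : 0 < d) (hn : 0 ≤ n) (hR : 0 < R) (hK : 63 ≤ K)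
    (hδD : 0 ≤ δ * D) (hnρ : n * ρ ^ 2 = δ * d * D) (hM : M + 486 * Δ ^ 4 ≤ 486 * R ^ 2) :
    n * ((ρ / (K * R * d)) ^ 2 * (d * (8 * (M + 486 * Δ ^ 4)))) ≤ δ * D := by
  have hK0 : 0 < K := by linarith
  calc n * ((ρ / (K * R * d)) ^ 2 * (d * (8 * (M + 486 * Δ ^ 4))))
      ≤ n * ((ρ / (K * R * d)) ^ 2 * (d * (8 * (486 * R ^ 2)))) := by gcongr
    _ = 3888 * (n * ρ ^ 2) / (K ^ 2 * d) := by field_simp; ring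
    _ = 3888 / K ^ 2 * (δ * D) := by rw [hnρ]; field_simp
    _ ≤ δ * D := by
      refine mul_le_of_le_one_left hδD ((div_le_one (pow_pos hK0 2)).2 ?_)
      nlinarith

lemma one_add_two_mul_le_mul_max (hδ : 0 < δ) (hK : 0 ≤ K) (hκ : 0 ≤ κ) :
    K * (1 + 2 * δ) ≤ δ * ((3 * K + κ) * max 1 (1 / δ) - κ) := by
  have hmax : δ * max 1 (1 / δ) = max δ 1 := by
    rw [mul_max_of_nonneg _ _ hδ.le, mul_one, mul_one_div_cancel hδ.ne']
  calc K * (1 + 2 * δ) ≤ K * (3 * max δ 1) + κ * (max δ 1 - δ) := by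
        have : K * (1 + 2 * δ) ≤ K * (3 * max δ 1) := by
          gcongr
          linarith [le_max_left δ 1, le_max_right δ 1]
        linarith [mul_nonneg hκ (sub_nonneg.2 (le_max_left δ 1))]
    _ = δ * ((3 * K + κ) * max 1 (1 / δ) - κ) := by rw [← hmax]; ring

lemma le_temperature_mul_deviation (hd : 0 < d) (hn : 0 ≤ n) (hR : 0 < R) (hK : 0 < K)
    (hκ : 0 ≤ κ) (hδ : 0 < δ) (hD : 0 ≤ D) (hρ : 0 ≤ ρ) (hnρ : n * ρ ^ 2 = δ * d * D)
    (hb : b ≤ κ * (R * ρ)) :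
    (1 + 2 * δ) * D ≤
      ρ / (K * R * d) * (n * ((3 * K + κ) * max 1 (1 / δ) * (R * ρ) - b)) := by
  set X := (3 * K + κ) * max 1 (1 / δ)
  calc (1 + 2 * δ) * D = K * (1 + 2 * δ) * (D / K) := by field_simp
    _ ≤ δ * (X - κ) * (D / K) := by
      gcongr ?_ * _
      exact one_add_two_mul_le_mul_max hδ hK.le hκ
    _ = n * ρ ^ 2 / (K * d) * (X - κ) := by rw [hnρ]; field_simp
    _ = ρ / (K * R * d) * (n * (X * (R * ρ) - κ * (R * ρ))) := by field_simp
    _ ≤ ρ / (K * R * d) * (n * (X * (R * ρ) - b)) := by gcongr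

lemma exists_temperature (hc₀ : 0 < c₀) (hc₁ : 0 < c₁) (hd : 0 < d) (hn : 0 < n) (hD : 0 < D)
    (hδ : 0 < δ) (hΔ : 0 < Δ) (hM : 0 ≤ M) (hζ : 0 ≤ ζ)
    (hζc₁ : c₁ * ((M ^ ((1 : ℝ) / 4) + Δ) * (n / (δ * D)) ^ ((1 : ℝ) / 4)) ≤ ζ)
    (hζc₂ : ζ ≤ c₂ * ((M ^ ((1 : ℝ) / 4) + Δ) * (n / (δ * D)) ^ ((1 : ℝ) / 4)))
    (hnc₀ : c₀ * (δ * d * D) ≤ n) :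
    ∃ θ : ℝ, 0 < θ ∧ θ * (2 * (√d * ζ ^ 2) + 9 / 2 * (d * Δ ^ 2)) ≤ 1 ∧
      n * (θ ^ 2 * (d * (8 * (M + 486 * Δ ^ 4)))) -
        θ * (n * ((3 * temperatureConst c₀ c₂ + 1 / c₁ ^ 2) * max 1 (1 / δ) *
          ((√M + Δ ^ 2) * √(δ * d * D / n)) - M * √d / ζ ^ 2)) ≤ -(1 + δ) * D := by
  set ρ := √(δ * d * D / n)
  have hK := le_temperatureConst c₀ c₂
  have hR : 0 < √M + Δ ^ 2 := by positivity
  have hρ : 0 < ρ := Real.sqrt_pos.2 (by positivity)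
  have ht : 0 < n / (δ * D) := by positivity
  have hnρ : n * ρ ^ 2 = δ * d * D := by rw [Real.sq_sqrt (by positivity)]; field_simp
  have htρ : √(n / (δ * D)) * ρ = √d := by
    rw [← Real.sqrt_mul ht.le]; congr 1; field_simp
  have hρc₀ : √c₀ * ρ ≤ 1 := by
    rwa [← Real.sqrt_mul hc₀.le, Real.sqrt_le_one, mul_div_assoc', div_le_one hn]
  have hlower : c₁ ^ 2 * ((√M + Δ ^ 2) * √(n / (δ * D))) ≤ ζ ^ 2 :=
    (mul_le_mul_of_nonneg_left (mul_sqrt_le_threshold_scale_sq hM hΔ.le ht.le)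
      (sq_nonneg c₁)).trans (by rw [← mul_pow]; gcongr)
  have hupper : ζ ^ 2 ≤ c₂ ^ 2 * (2 * (√M + Δ ^ 2) * √(n / (δ * D))) :=
    (pow_le_pow_left₀ hζ hζc₂ 2).trans (by
      rw [mul_pow]; gcongr; exact threshold_scale_sq_le_mul_sqrt hM ht.le)
  have hMR : M ≤ (√M + Δ ^ 2) ^ 2 := by
    calc M = √M ^ 2 := (Real.sq_sqrt hM).symm
      _ ≤ (√M + Δ ^ 2) ^ 2 := by gcongr; exact le_add_of_nonneg_right (sq_nonneg Δ)
  refine ⟨ρ / (temperatureConst c₀ c₂ * (√M + Δ ^ 2) * d), by positivity,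
    temperature_mul_le_one hc₀ hd hR (le_add_of_nonneg_left (Real.sqrt_nonneg M)) hρ.le hρc₀ htρ
      hupper, ?_⟩
  have hvariance := temperature_variance_le hd hn.le hR hK (by positivity) hnρ
    (add_mul_pow_four_le (Δ := Δ) hM)
  have hdeviation := le_temperature_mul_deviation hd hn.le hR
    (K := temperatureConst c₀ c₂) (by linarith) (by positivity) hδ hD.le hρ.le hnρ
    (bias_le hc₁ hR hMR ht htρ hlower)
  linarith

end ParameterChoice

end QCE

theorem theorem3p2_general (c₀ c₁ c₂ : ℝ) (hc₀ : 0 < c₀) (hc₁ : 0 < c₁) :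
    ∃ C : ℝ, 0 < C ∧
      ∀ (d n : ℕ) (δ Δ M ζ : ℝ) (P : Measure (Fin d → ℝ))
        (Ω : Type*) [MeasurableSpace Ω] (μ : Measure Ω) (x τ : Fin n → Ω → Fin d → ℝ),
        2 ≤ d → 0 < δ → 0 < Δ →
        (∀ k, HasLaw (x k) P μ) →
        (∀ k, HasLaw (τ k) (QCE.triangularDither d Δ) μ) →
        iIndepFun (Sum.elim x τ) μ →
        QCE.HasFourthMomentBound P M →
        c₁ * ((M ^ ((1 : ℝ) / 4) + Δ) * (n / (δ * Real.log d)) ^ ((1 : ℝ) / 4)) ≤ ζ →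
        ζ ≤ c₂ * ((M ^ ((1 : ℝ) / 4) + Δ) * (n / (δ * Real.log d)) ^ ((1 : ℝ) / 4)) →
        c₀ * (δ * d * Real.log d) ≤ n →
        μ.real {ω | C * max 1 (1 / δ) * ((√M + Δ ^ 2) * √(δ * d * Real.log d / n)) ≤
            QCE.opNorm (QCE.estimator Δ ζ (fun k => x k ω) (fun k => τ k ω) -
              QCE.secondMoment P)} ≤
          2 * (d : ℝ) ^ (-δ) := by
  have hK := QCE.le_temperatureConst c₀ c₂
  refine ⟨3 * QCE.temperatureConst c₀ c₂ + 1 / c₁ ^ 2, by positivity, ?_⟩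
  intro d n δ Δ M ζ P Ω _ μ x τ hd hδ hΔ hx hτ hindep hP hζc₁ hζc₂ hnc₀
  have hd0 : (0 : ℝ) < d := by positivity
  have hlog : 0 < Real.log d := Real.log_pos (by exact_mod_cast hd)
  have hn0 : (0 : ℝ) < n := lt_of_lt_of_le (by positivity) hnc₀
  have hn : 0 < n := by exact_mod_cast hn0
  have := hindep.isProbabilityMeasure
  have : IsProbabilityMeasure P := (hx ⟨0, hn⟩).isProbabilityMeasure_iff.1 this
  have hM : 0 ≤ M := hP.nonneg ⟨0, by lia⟩
  have hζ : 0 < ζ := lt_of_lt_of_le (by positivity) hζc₁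
  obtain ⟨θ, hθ, hθL, hexponent⟩ :=
    QCE.exists_temperature hc₀ hc₁ hd0 hn0 hlog hδ hΔ hM hζ.le hζc₁ hζc₂ hnc₀
  calc _ ≤ 2 * d * Real.exp _ := QCE.measureReal_le_opNorm_estimator_sub_le hP (by lia) hn.ne' hΔ hζ
        hx hτ hindep hθ hθL _
    _ ≤ 2 * d * Real.exp (-(1 + δ) * Real.log d) := by gcongr
    _ = 2 * (d : ℝ) ^ (-δ) := by
      rw [mul_comm (-(1 + δ)), ← Real.rpow_def_of_pos hd0, mul_assoc, mul_comm (d : ℝ),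
        ← Real.rpow_add_one hd0.ne', neg_add_rev, neg_add_cancel_right]

theorem theorem3p2 (c₀ c₁ c₂ : ℝ) (hc₀ : 0 < c₀) (hc₁ : 0 < c₁) (hc₂ : 0 < c₂) :
    ∃ C : ℝ, 0 < C ∧
      ∀ (d n : ℕ) (δ Δ M ζ : ℝ) (P : Measure (Fin d → ℝ))
        (Ω : Type*) [MeasurableSpace Ω] (μ : Measure Ω) [IsProbabilityMeasure μ]
        (x τ : Fin n → Ω → Fin d → ℝ),
        2 ≤ d → 0 < δ → 0 < Δ →
        -- the data have common law `P`, the dithers are triangular, and all are independent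
        (∀ k, HasLaw (x k) P μ) →
        (∀ k, HasLaw (τ k) (QCE.triangularDither d Δ) μ) →
        iIndepFun (Sum.elim x τ) μ →
        -- `P` is centered with fourth moments at most `M` in every direction
        (∀ i, ∫ y, y i ∂P = 0) →
        (∀ v : Fin d → ℝ, v ⬝ᵥ v = 1 →
          Integrable (fun y => |v ⬝ᵥ y| ^ 4) P ∧ ∫ y, |v ⬝ᵥ y| ^ 4 ∂P ≤ M) →
        -- the order of the truncation threshold and the sample size condition
        c₁ * ((M ^ ((1 : ℝ) / 4) + Δ) * (n / (δ * Real.log d)) ^ ((1 : ℝ) / 4)) ≤ ζ →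
        ζ ≤ c₂ * ((M ^ ((1 : ℝ) / 4) + Δ) * (n / (δ * Real.log d)) ^ ((1 : ℝ) / 4)) →
        c₀ * (δ * d * Real.log d) ≤ n →
        μ.real {ω | C * max 1 (1 / δ) * ((√M + Δ ^ 2) * √(δ * d * Real.log d / n)) ≤
            QCE.opNorm (QCE.estimator Δ ζ (fun k => x k ω) (fun k => τ k ω) -
              QCE.secondMoment P)} ≤
          2 * (d : ℝ) ^ (-δ) := by
  obtain ⟨C, hC, h⟩ := theorem3p2_general c₀ c₁ c₂ hc₀ hc₁
  exact ⟨C, hC, fun d n δ Δ M ζ P Ω _ μ _ x τ hd hδ hΔ hx hτ hindep _ =>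
    h d n δ Δ M ζ P Ω μ x τ hd hδ hΔ hx hτ hindep⟩
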